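/- Let $\Sigma$ be a finite simplicial complex and $d\ge 0$. Write $\Sigma_d$ for the set of its $d$-simplices (faces with $d+1$ vertices) and $n=\#\Sigma_d$. Fix an arbitrary orientation $[\sigma]$ of every simplex $\sigma$, and let $\operatorname{sgn}([\tau],\partial[\rho])\in\{-1,0,1\}$ be the coefficient of $[\tau]$ in $\partial[\rho]$ for $\tau\in\Sigma_d$, $\rho\in\Sigma_{d+1}$. Let $\deg\tau=\#\{\rho\in\Sigma_{d+1}:\tau\subset\rho\}$ and let $n_+$ be the number of $\tau\in\Sigma_d$ with $\deg\tau>0$ (so $n_+=n$ if all degrees are positive). Let $\Delta_d^{up}=\delta_d^*\delta_d$ be the normalized up-Laplacian on $C^d(\Sigma)\cong\mathbb{R}^{\Sigma_d}$, that is, $$(\Delta_d^{up}f)([\tau])=\frac1{\deg\tau}\sum_{\rho\in\Sigma_{d+1},\,\rho\supset\tau}\operatorname{sgn}([\tau],\partial[\rho])\sum_{\tau'\in\Sigma_d,\,\tau'\subset\rho}\operatorname{sgn}([\tau'],\partial[\rho])f([\tau']),$$ read as $0$ when $\deg\tau=0$. It has $n$ real eigenvalues counted with multiplicity, $\lambda_1(\Delta_d^{up})\le\dots\le\lambda_n(\Delta_d^{up})$.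 Let $\Gamma_d$ be the graph on $\Sigma_d$ in which two different $\tau,\tau'$ are adjacent if they are facets of a common $\rho\in\Sigma_{d+1}$ (which is then unique), with edge sign $s(\tau,\tau')=\operatorname{sgn}([\tau],\partial[\rho])\operatorname{sgn}([\tau'],\partial[\rho])$. For disjoint $A,A'\subset\Sigma_d$ let $E^-(A)$ be the set of edges of sign $-1$ with both ends in $A$, let $E^+(A,A')$ be the set of edges of sign $+1$ with one end in $A$ and the other in $A'$, let $|\partial A|$ be the number of edges between $A$ and $\Sigma_d\setminus A$, let $\operatorname{vol}(A)=\sum_{\tau\in A}\deg\tau$, and, if $\operatorname{vol}(A\sqcup A')>0$, let $$\beta(A,A')=\frac{2\left(|E^-(A)|+|E^-(A')|+|E^+(A,A')|\right)+|\partial(A\sqcup A')|}{\operatorname{vol}(A\sqcup A')}.$$ For $1\le k\le n_+$ let $$h_k(\Sigma_d)=\min_{A_1,\dots,A_{2k}}\ \max_{1\le i\le k}\beta(A_{2i-1},A_{2i}),$$ the minimum being over all pairwise disjoint $A_1,\dots,A_{2k}\subset\Sigma_d$ with $\operatorname{vol}(A_{2i-1}\sqcup A_{2i})>0$ for all $i$.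 **Theorem.** If $n_+\ge1$, then $$\frac{h_1(\Sigma_d)^2}{2(d+1)}\le d+2-\lambda_n(\Delta_d^{up})\le 2h_1(\Sigma_d).$$ Moreover, there is an absolute constant $C>0$ such that for every finite simplicial complex $\Sigma$, every $d\ge0$ and every $k$ with $1\le k\le n_+$, $$\frac{h_k(\Sigma_d)^2}{Ck^6(d+1)}\le d+2-\lambda_{n+1-k}(\Delta_d^{up})\le 2h_k(\Sigma_d).$$ -/

import Mathlib

namespace SimplicialCheeger

variable {V : Type*}

/-- The set `Σ_d` of `d`-simplices (faces with `d + 1` vertices) of a simplicial complex. -/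
def Simplex (K : PreAbstractSimplicialComplex V) (d : ℕ) : Type _ :=
  {σ : Finset V // σ ∈ K.faces ∧ σ.card = d + 1}

noncomputable instance [Finite V] (K : PreAbstractSimplicialComplex V) (d : ℕ) :
    Fintype (Simplex K d) :=
  @Fintype.ofFinite _ (inferInstanceAs
    (Finite {σ : Finset V // σ ∈ K.faces ∧ σ.card = d + 1}))

noncomputable instance (K : PreAbstractSimplicialComplex V) (d : ℕ) :
    DecidableEq (Simplex K d) := Classical.decEq _

/-- A choice of orientation of every simplex of `K`: an orientation is represented by an ordering
`[v_0, …, v_d]` of the vertices (two orderings that differ by an even permutation are the same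
orientation). The ordering chosen for different simplices need not be compatible. -/
def SimplexOrientation (K : PreAbstractSimplicialComplex V) : Type _ :=
  ∀ (d : ℕ) (σ : Simplex K d), Fin (d + 1) ≃ {v : V // v ∈ σ.1}

variable {K : PreAbstractSimplicialComplex V}

open Classical in
/-- `sgn([τ], ∂[ρ])`: the coefficient of `[τ]` in
`∂[v_0, …, v_{d+1}] = ∑_j (-1)^j [v_0, …, v_{j-1}, v_{j+1}, …, v_{d+1}]`,
where `[ρ] = [v_0, …, v_{d+1}]`. The ordered simplex `[v_0, …, v_{j-1}, v_{j+1}, …, v_{d+1}]` is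
`sign π • [τ]` if it arises from the ordering of `τ` by the permutation `π`. At most one pair
`(j, π)` contributes, and none does if `τ` is not a facet of `ρ`. -/
noncomputable def sgn (o : SimplexOrientation K) {d : ℕ}
    (τ : Simplex K d) (ρ : Simplex K (d + 1)) : ℤ :=
  ∑ j : Fin (d + 2), ∑ π : Equiv.Perm (Fin (d + 1)),
    if ∀ i, ((o (d + 1) ρ (j.succAbove i) : {v : V // v ∈ ρ.1}) : V) = (o d τ (π i) : V) then
      (-1) ^ (j : ℕ) * ((Equiv.Perm.sign π : ℤˣ) : ℤ)
    else 0

/-- `deg τ`, the number of `(d+1)`-simplices containing the `d`-simplex `τ`. -/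
noncomputable def deg {d : ℕ} (τ : Simplex K d) : ℕ :=
  {ρ : Simplex K (d + 1) | τ.1 ⊆ ρ.1}.ncard

theorem subset_of_sgn_ne_zero (o : SimplexOrientation K) {d : ℕ} (τ : Simplex K d)
    (ρ : Simplex K (d + 1)) (h : sgn o τ ρ ≠ 0) : τ.1 ⊆ ρ.1 := by
  classical
  by_contra hs
  refine h (Finset.sum_eq_zero fun j _ => Finset.sum_eq_zero fun π _ => if_neg fun hj => hs ?_)
  intro v hv
  have h1 := hj (π.symm ((o d τ).symm ⟨v, hv⟩))
  simp only [Equiv.apply_symm_apply] at h1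
  exact h1 ▸ (o (d + 1) ρ _).2

section Laplacian

variable [Finite V]

/-- The coboundary `δ_d : C^d → C^{d+1}`, cochains being written in the bases given by the chosen
orientations: `(δf)([ρ]) = ∑_τ sgn([τ], ∂[ρ]) f([τ])`. -/
noncomputable def coboundary (o : SimplexOrientation K) (d : ℕ) :
    Matrix (Simplex K (d + 1)) (Simplex K d) ℝ :=
  Matrix.of fun ρ τ => (sgn o τ ρ : ℝ)

/-- The adjoint `δ_d^* : C^{d+1} → C^d` of the coboundary for the scalar products
`∑_τ deg τ f(τ) g(τ)` on `C^d` and `∑_ρ f(ρ) g(ρ)` on `C^{d+1}` (see `inner_coboundary`).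
A row that belongs to a simplex of degree `0` is `0`. -/
noncomputable def coboundaryAdjoint (o : SimplexOrientation K) (d : ℕ) :
    Matrix (Simplex K d) (Simplex K (d + 1)) ℝ :=
  Matrix.of fun τ ρ => (deg τ : ℝ)⁻¹ * (sgn o τ ρ : ℝ)

/-- The normalized up-Laplacian `Δ_d^{up} = δ_d^* δ_d`. -/
noncomputable def upLaplacian (o : SimplexOrientation K) (d : ℕ) :
    Matrix (Simplex K d) (Simplex K d) ℝ :=
  coboundaryAdjoint o d * coboundary o d

/-- `λ_i(Δ_d^{up})`, for `1 ≤ i ≤ #Σ_d`: the `i`-th smallest eigenvalue, counted with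
multiplicity. (By `card_roots_upLaplacian` there are exactly `#Σ_d` real eigenvalues.) -/
noncomputable def eigenvalue (o : SimplexOrientation K) (d i : ℕ) : ℝ :=
  ((upLaplacian o d).charpoly.roots.sort (· ≤ ·)).getD (i - 1) 0

theorem deg_pos_of_sgn_ne_zero (o : SimplexOrientation K) {d : ℕ} (τ : Simplex K d)
    (ρ : Simplex K (d + 1)) (h : sgn o τ ρ ≠ 0) : 0 < deg τ :=
  (Set.ncard_pos (Set.toFinite _)).2 ⟨ρ, subset_of_sgn_ne_zero o τ ρ h⟩

theorem inner_coboundary (o : SimplexOrientation K) (d : ℕ) (f : Simplex K d → ℝ)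
    (g : Simplex K (d + 1) → ℝ) :
    ∑ ρ, (coboundary o d).mulVec f ρ * g ρ =
      ∑ τ, (deg τ : ℝ) * (f τ * (coboundaryAdjoint o d).mulVec g τ) := by
  simp only [Matrix.mulVec, dotProduct, coboundary, coboundaryAdjoint, Matrix.of_apply,
    Finset.sum_mul, Finset.mul_sum]
  rw [Finset.sum_comm]
  refine Finset.sum_congr rfl fun τ _ => Finset.sum_congr rfl fun ρ _ => ?_
  by_cases h : sgn o τ ρ = 0
  · simp [h]
  · have : (deg τ : ℝ) ≠ 0 := by exact_mod_cast (deg_pos_of_sgn_ne_zero o τ ρ h).ne'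
    field_simp

theorem card_roots_upLaplacian (o : SimplexOrientation K) (d : ℕ) :
    (upLaplacian o d).charpoly.roots.card = Fintype.card (Simplex K d) := by
  set W : Matrix (Simplex K d) (Simplex K d) ℝ :=
    Matrix.diagonal fun τ => Real.sqrt ((deg τ : ℝ)⁻¹) with hW
  have h1 : upLaplacian o d = W * (W * ((coboundary o d).transpose * coboundary o d)) := by
    rw [upLaplacian, ← Matrix.mul_assoc, ← Matrix.mul_assoc]
    congr 1
    ext τ ρ
    rw [hW, Matrix.diagonal_mul_diagonal, Matrix.diagonal_mul]
    simp only [coboundary, coboundaryAdjoint, Matrix.of_apply]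
    rw [Real.mul_self_sqrt (by positivity)]
    rfl
  have h2 : (W * ((coboundary o d).transpose * coboundary o d) * W).IsHermitian := by
    have hWt : W.transpose = W := Matrix.diagonal_transpose _
    rw [Matrix.IsHermitian, Matrix.conjTranspose_eq_transpose_of_trivial]
    simp only [Matrix.transpose_mul, hWt, Matrix.transpose_transpose, Matrix.mul_assoc]
  rw [h1, Matrix.charpoly_mul_comm, h2.roots_charpoly_eq_eigenvalues]
  simp

end Laplacian

/-- The graph `Γ_d` on `Σ_d`: two different `d`-simplices are adjacent if they are facets of a
common `(d+1)`-simplex. -/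
def upGraph (K : PreAbstractSimplicialComplex V) (d : ℕ) : SimpleGraph (Simplex K d) where
  Adj τ τ' := τ ≠ τ' ∧ ∃ ρ : Simplex K (d + 1), τ.1 ⊆ ρ.1 ∧ τ'.1 ⊆ ρ.1
  symm := ⟨fun _ _ h => ⟨h.1.symm, h.2.imp fun _ hρ => hρ.symm⟩⟩
  loopless := ⟨fun _ h => h.1 rfl⟩

section Cheeger

variable [Finite V]

/-- The sign `s([τ],[τ']) = sgn([τ], ∂[ρ]) sgn([τ'], ∂[ρ])` of an edge of `Γ_d`, with `ρ` the unique
`(d+1)`-simplex that has `τ` and `τ'` as facets. (All other terms of the sum are `0`.) -/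
noncomputable def edgeSign (o : SimplexOrientation K) {d : ℕ} (τ τ' : Simplex K d) : ℤ :=
  ∑ ρ : Simplex K (d + 1), sgn o τ ρ * sgn o τ' ρ

/-- The number of (unordered) edges of `Γ_d` of sign `c` with one end in `A` and the other in `B`.
So `|E⁻(A)| = signedEdges o (-1) A A` and `|E⁺(A, A')| = signedEdges o 1 A A'`. -/
noncomputable def signedEdges (o : SimplexOrientation K) {d : ℕ} (c : ℤ)
    (A B : Finset (Simplex K d)) : ℕ :=
  {e : Sym2 (Simplex K d) | ∃ τ ∈ A, ∃ τ' ∈ B,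
    e = s(τ, τ') ∧ (upGraph K d).Adj τ τ' ∧ edgeSign o τ τ' = c}.ncard

/-- `|∂A|`, the number of edges of `Γ_d` between `A` and its complement. -/
noncomputable def boundarySize {d : ℕ} (A : Finset (Simplex K d)) : ℕ :=
  {e : Sym2 (Simplex K d) | ∃ τ ∈ A, ∃ τ' ∉ A, e = s(τ, τ') ∧ (upGraph K d).Adj τ τ'}.ncard

/-- `vol(A) = ∑_{τ ∈ A} deg τ`. -/
noncomputable def vol {d : ℕ} (A : Finset (Simplex K d)) : ℕ := ∑ τ ∈ A, deg τ

/-- The signed bipartiteness ratio `β(A, A')`. -/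
noncomputable def beta (o : SimplexOrientation K) {d : ℕ} (A A' : Finset (Simplex K d)) : ℝ :=
  (2 * ((signedEdges o (-1) A A : ℝ) + signedEdges o (-1) A' A' + signedEdges o 1 A A')
    + boundarySize (A ∪ A')) / vol (A ∪ A')

/-- A family of `2k` pairwise disjoint sets of `d`-simplices, grouped into `k` pairs
`(A (i, 0), A (i, 1))`, such that `β` is defined for each pair, that is, each pair has positive
volume. If all degrees are positive this says that no pair is `(∅, ∅)`. -/
def IsAdmissible {d k : ℕ} (A : Fin k × Fin 2 → Finset (Simplex K d)) : Prop :=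
  Pairwise (fun p q => Disjoint (A p) (A q)) ∧ ∀ i, 0 < vol (A (i, 0) ∪ A (i, 1))

/-- The `k`-th Cheeger constant `h_k(Σ_d)`. -/
noncomputable def cheeger (o : SimplexOrientation K) (d k : ℕ) : ℝ :=
  ⨅ A : {A : Fin k × Fin 2 → Finset (Simplex K d) // IsAdmissible A},
    ⨆ i : Fin k, beta o (A.1 (i, 0)) (A.1 (i, 1))

end Cheeger

end SimplicialCheeger

/-! The theorem is a Cheeger inequality for signed graphs. Write N(f) = ∑ deg τ f(τ)² and let E(f)
be the sum of (f(τ) - s f(τ'))² over the edges of Γ_d. Distinct d-simplices have at most one common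
coface, and a coface of τ has d + 1 other facets, so τ has (d + 1) deg τ neighbours in Γ_d
(`sum_abs_signedAdj`). Expanding squares gives E(f) = (d + 2) N(f) - ‖δf‖²
(`signedEnergy_signedAdj`). Hence, for k ≤ n_+, d + 2 - λ_{n+1-k} is the k-th min-max value of E /
N.

Upper bound: for disjoint A, A' the function 1_A - 1_{A'} has total variation equal to the numerator
of β (`signedVariation_pairSign`). An admissible family gives k such functions with disjoint
supports, and on their span E is at most 2 max β times N (`IsAdmissible.signedEnergy_le`); min-max
does the rest (`le_eigenvalue_of_le_on_span`).

Lower bound, one function: if all pairs of level sets {f > √t}, {f ≤ 0, f² > t} have ratio at least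
h, integrating over t and applying Cauchy–Schwarz gives h² N(f) ≤ 2(d + 1) E(f)
(`sq_mul_sum_le_signedEnergy`). For k = 1 this is applied to a top eigenfunction.

Lower bound, general k: k orthonormal eigenfunctions form a map F to ℝ^k whose directions, weighted
by deg ‖F‖², are isotropic. Directions are compared up to sign, so that edge signs do no harm. A
small ball carries weight little more than 1 out of a total of k; carving random balls and merging
the pieces yields k groups of weight at least 1/2 that are far apart (`exists_separated_groups`).
Cutting F off around each group and choosing a good coordinate gives k disjointly supported
functions whose Rayleigh quotients grow by at most a factor of order k⁶
(`exists_disjoint_support_signedEnergy_le`). The one-function bound then applies to each of them. -/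

namespace SimplicialCheeger

/-! ### Cheeger's inequality for one function on a signed graph. -/

section SignedGraph

variable {X : Type*}

/-- The sign of `f` on the superlevel set `{t < f²}`. -/
noncomputable def levelSign (f : X → ℝ) (t : ℝ) (x : X) : ℝ :=
  if t < f x ^ 2 then (if 0 < f x then 1 else -1) else 0

/-- The function `1_{t < a}`. -/
noncomputable def below (a t : ℝ) : ℝ := if t < a then 1 else 0

theorem below_eq_indicator (a : ℝ) : below a = (Set.Iio a).indicator 1 := by
  ext t
  simp [below, Set.indicator_apply]

theorem intervalIntegrable_below (a M : ℝ) :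
    IntervalIntegrable (below a) MeasureTheory.volume 0 M := by
  rw [below_eq_indicator, intervalIntegrable_iff]
  exact (intervalIntegrable_iff.1 (intervalIntegrable_const (c := (1 : ℝ)))).indicator
    measurableSet_Iio

theorem integral_below {a M : ℝ} (ha : 0 ≤ a) (haM : a ≤ M) :
    ∫ t in (0 : ℝ)..M, below a t = a := by
  rw [intervalIntegral.integral_of_le (ha.trans haM), below_eq_indicator,
    MeasureTheory.integral_indicator_one measurableSet_Iio, MeasureTheory.measureReal_def,
    MeasureTheory.Measure.restrict_apply measurableSet_Iio]
  have : Set.Iio a ∩ Set.Ioc 0 M = Set.Ioo 0 a := by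
    ext t
    simp only [Set.mem_inter_iff, Set.mem_Iio, Set.mem_Ioc, Set.mem_Ioo]
    constructor
    · rintro ⟨h1, h2, -⟩
      exact ⟨h2, h1⟩
    · rintro ⟨h1, h2⟩
      exact ⟨h2, h1, (h2.le.trans haM)⟩
  rw [this, Real.volume_Ioo, sub_zero, ENNReal.toReal_ofReal ha]

theorem abs_levelSign (f : X → ℝ) (t : ℝ) (x : X) : |levelSign f t x| = below (f x ^ 2) t := by
  unfold levelSign below
  split_ifs <;> simp

/-- If f x and s f y do not have opposite signs, the level signs differ only for t between the two
squares; if they do, each end contributes independently. -/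
theorem abs_levelSign_sub_le (f : X → ℝ) (x y : X) {s : ℝ} (hs : s = 1 ∨ s = -1) {t : ℝ}
    (ht : 0 ≤ t) :
    |levelSign f t x - s * levelSign f t y| =
      if 0 ≤ s * (f x * f y) then below (max (f x ^ 2) (f y ^ 2)) t -
        below (min (f x ^ 2) (f y ^ 2)) t
      else below (f x ^ 2) t + below (f y ^ 2) t := by
  have hx0 : t < f x ^ 2 → f x ≠ 0 := by
    rintro h h0
    rw [h0] at h
    norm_num at h
    linarith
  have hy0 : t < f y ^ 2 → f y ≠ 0 := by
    rintro h h0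
    rw [h0] at h
    norm_num at h
    linarith
  unfold levelSign below
  simp only [lt_max_iff, lt_min_iff]
  by_cases hx : t < f x ^ 2 <;> by_cases hy : t < f y ^ 2 <;>
    simp only [hx, hy, if_true, if_false, or_true, and_true, and_false, or_false,
      or_self, mul_zero]
  · rcases lt_or_gt_of_ne (hx0 hx) with h1 | h1 <;> rcases lt_or_gt_of_ne (hy0 hy) with h2 | h2
    · have h3 := mul_pos_of_neg_of_neg h1 h2
      rcases hs with rfl | rfl
      · simp [h1.not_gt, h2.not_gt, h3.le]
      · simp [h1.not_gt, h2.not_gt]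
        norm_num
        assumption
    · have h3 := mul_neg_of_neg_of_pos h1 h2
      rcases hs with rfl | rfl
      · simp [h1.not_gt, h2]
        norm_num
        assumption
      · simp [h1.not_gt, h2, h3.le]
    · have h3 := mul_neg_of_pos_of_neg h1 h2
      rcases hs with rfl | rfl
      · simp [h1, h2.not_gt]
        norm_num
        assumption
      · simp [h1, h2.not_gt, h3.le]
    · have h3 := mul_pos h1 h2
      rcases hs with rfl | rfl
      · simp [h1, h2, h3.le]
      · simp [h1, h2]
        norm_num
        assumption
  · split_ifs <;> simp
  · rcases hs with rfl | rfl <;> split_ifs <;> simp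
  · simp

theorem intervalIntegrable_abs_levelSign_sub (f : X → ℝ) (x y : X) {s : ℝ}
    (hs : s = 1 ∨ s = -1) {M : ℝ} (hM : 0 ≤ M) :
    IntervalIntegrable (fun t => |levelSign f t x - s * levelSign f t y|)
      MeasureTheory.volume 0 M := by
  have : IntervalIntegrable (fun t => if 0 ≤ s * (f x * f y) then
      below (max (f x ^ 2) (f y ^ 2)) t - below (min (f x ^ 2) (f y ^ 2)) t
      else below (f x ^ 2) t + below (f y ^ 2) t) MeasureTheory.volume 0 M := by
    split_ifs
    · exact (intervalIntegrable_below _ _).sub (intervalIntegrable_below _ _)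
    · exact (intervalIntegrable_below _ _).add (intervalIntegrable_below _ _)
  refine this.congr fun t ht => ?_
  rw [Set.uIoc_of_le hM] at ht
  exact (abs_levelSign_sub_le f x y hs ht.1.le).symm

/-- The integral is |f x² - f y²| = |f x - s f y| |f x + s f y| in the case of agreeing signs.
Otherwise it is f x² + f y², while |f x - s f y| = |f x| + |f y|. -/
theorem integral_abs_levelSign_sub_le (f : X → ℝ) (x y : X) {s : ℝ}
    (hs : s = 1 ∨ s = -1) {M : ℝ} (hx : f x ^ 2 ≤ M) (hy : f y ^ 2 ≤ M) :
    ∫ t in (0 : ℝ)..M, |levelSign f t x - s * levelSign f t y| ≤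
      |f x - s * f y| * (|f x| + |f y|) := by
  have hM : 0 ≤ M := (sq_nonneg _).trans hx
  have h1 : ∫ t in (0 : ℝ)..M, |levelSign f t x - s * levelSign f t y| =
      ∫ t in (0 : ℝ)..M, if 0 ≤ s * (f x * f y) then
      below (max (f x ^ 2) (f y ^ 2)) t - below (min (f x ^ 2) (f y ^ 2)) t
      else below (f x ^ 2) t + below (f y ^ 2) t := by
    refine intervalIntegral.integral_congr fun t ht => ?_
    rw [Set.uIcc_of_le hM] at ht
    exact abs_levelSign_sub_le f x y hs ht.1
  rw [h1]
  split_ifs with h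
  · rw [intervalIntegral.integral_sub (intervalIntegrable_below _ _)
      (intervalIntegrable_below _ _), integral_below (le_max_of_le_left (sq_nonneg _))
      (max_le hx hy), integral_below (le_min (sq_nonneg _) (sq_nonneg _))
      (min_le_of_left_le hx), max_sub_min_eq_abs]
    have h2 : |f y ^ 2 - f x ^ 2| = |f x - s * f y| * |f x + s * f y| := by
      rw [← abs_mul, abs_sub_comm]
      congr 1
      rcases hs with rfl | rfl <;> ring
    rw [h2]
    refine mul_le_mul_of_nonneg_left ((abs_add_le _ _).trans ?_) (abs_nonneg _)
    rcases hs with rfl | rfl <;> simp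
  · rw [intervalIntegral.integral_add (intervalIntegrable_below _ _)
      (intervalIntegrable_below _ _), integral_below (sq_nonneg _) hx,
      integral_below (sq_nonneg _) hy]
    push Not at h
    have h2 : |f x - s * f y| = |f x| + |f y| := by
      rcases hs with rfl | rfl
      · rw [one_mul] at h ⊢
        rcases mul_neg_iff.1 h with ⟨h3, h4⟩ | ⟨h3, h4⟩
        · rw [abs_of_pos h3, abs_of_neg h4, abs_of_pos (by linarith)]; ring
        · rw [abs_of_neg h3, abs_of_pos h4, abs_of_neg (by linarith)]; ring
      · have h : 0 < f x * f y := by linarith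
        rcases mul_pos_iff.1 h with ⟨h3, h4⟩ | ⟨h3, h4⟩
        · rw [abs_of_pos h3, abs_of_pos h4, abs_of_pos (by linarith)]; ring
        · rw [abs_of_neg h3, abs_of_neg h4, abs_of_neg (by linarith)]; ring
    rw [h2, ← sq_abs (f x), ← sq_abs (f y)]
    nlinarith [abs_nonneg (f x), abs_nonneg (f y), mul_nonneg (abs_nonneg (f x)) (abs_nonneg (f y))]

variable [Fintype X]

/-- The energy `∑ (f x - σ(x, y) f y)²` over the edges of a signed graph, given by its signed
adjacency matrix `σ`. -/
noncomputable def signedEnergy (σ : X → X → ℝ) (f : X → ℝ) : ℝ :=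
  (∑ x, ∑ y, |σ x y| * (f x - σ x y * f y) ^ 2) / 2

/-- The total variation `∑ |f x - σ(x, y) f y|` over the edges of a signed graph. -/
noncomputable def signedVariation (σ : X → X → ℝ) (f : X → ℝ) : ℝ :=
  (∑ x, ∑ y, |σ x y| * |f x - σ x y * f y|) / 2

theorem signedEnergy_nonneg (σ : X → X → ℝ) (f : X → ℝ) : 0 ≤ signedEnergy σ f := by
  unfold signedEnergy
  positivity

theorem sum_abs_mul_sq_add_sq {σ : X → X → ℝ} (hsymm : ∀ x y, σ x y = σ y x) {m : X → ℝ} {D : ℝ}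
    (hdeg : ∀ x, ∑ y, |σ x y| = D * m x) (f : X → ℝ) :
    ∑ x, ∑ y, |σ x y| * (f x ^ 2 + f y ^ 2) = 2 * D * ∑ x, m x * f x ^ 2 := by
  have h1 : ∑ x, ∑ y, |σ x y| * f x ^ 2 = D * ∑ x, m x * f x ^ 2 := by
    rw [Finset.mul_sum]
    refine Finset.sum_congr rfl fun x _ => ?_
    rw [← Finset.sum_mul, hdeg, mul_assoc]
  have h2 : ∑ x, ∑ y, |σ x y| * f y ^ 2 = D * ∑ x, m x * f x ^ 2 := by
    rw [Finset.sum_comm, ← h1]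
    simp only [hsymm]
  simp only [mul_add, Finset.sum_add_distrib, h1, h2]
  ring

/-- Cheeger's inequality for signed graphs: if all level pairs of `f` have signed bipartiteness
ratio at least `h`, then `h²` is bounded by the Rayleigh quotient of `f`. -/
theorem sq_mul_sum_le_signedEnergy {σ : X → X → ℝ}
    (hσ : ∀ x y, σ x y = 0 ∨ σ x y = 1 ∨ σ x y = -1) (hsymm : ∀ x y, σ x y = σ y x)
    {m : X → ℝ} (hm : ∀ x, 0 ≤ m x) {D : ℝ} (hD : 0 ≤ D)
    (hdeg : ∀ x, ∑ y, |σ x y| = D * m x) (f : X → ℝ) {h : ℝ} (hh : 0 ≤ h)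
    (hlevel : ∀ t, 0 ≤ t →
      h * ∑ x, m x * |levelSign f t x| ≤ signedVariation σ (levelSign f t)) :
    h ^ 2 * ∑ x, m x * f x ^ 2 ≤ 2 * D * signedEnergy σ f := by
  set N := ∑ x, m x * f x ^ 2 with hN
  have hN0 : 0 ≤ N := Finset.sum_nonneg fun x _ => mul_nonneg (hm x) (sq_nonneg _)
  set M := ∑ x, f x ^ 2 with hMdef
  have hM : ∀ x, f x ^ 2 ≤ M := fun x =>
    Finset.single_le_sum (f := fun x => f x ^ 2) (fun i _ => sq_nonneg _) (Finset.mem_univ x)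
  have hM0 : 0 ≤ M := Finset.sum_nonneg fun x _ => sq_nonneg _
  have hint1 : ∀ x, IntervalIntegrable (fun t => m x * |levelSign f t x|)
      MeasureTheory.volume 0 M := fun x => by
    simp only [abs_levelSign]
    exact (intervalIntegrable_below _ _).const_mul _
  have hint2 : ∀ x y, IntervalIntegrable
      (fun t => |σ x y| * |levelSign f t x - σ x y * levelSign f t y|)
      MeasureTheory.volume 0 M := fun x y => by
    rcases hσ x y with h0 | h0
    · simp [h0]
    · exact (intervalIntegrable_abs_levelSign_sub f x y h0 hM0).const_mul _
  have hint3 : ∀ x, IntervalIntegrable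
      (fun t => ∑ y, |σ x y| * |levelSign f t x - σ x y * levelSign f t y|)
      MeasureTheory.volume 0 M := fun x => by
    have := IntervalIntegrable.sum (Finset.univ) (fun y _ => hint2 x y)
    simpa only [Finset.sum_fn] using this
  have e1 : ∫ t in (0 : ℝ)..M, h * ∑ x, m x * |levelSign f t x| = h * N := by
    rw [intervalIntegral.integral_const_mul, intervalIntegral.integral_finsetSum fun x _ => hint1 x]
    congr 1
    refine Finset.sum_congr rfl fun x _ => ?_
    simp only [abs_levelSign]
    rw [intervalIntegral.integral_const_mul, integral_below (sq_nonneg _) (hM x)]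
  have e2 : ∫ t in (0 : ℝ)..M, signedVariation σ (levelSign f t) ≤
      (∑ x, ∑ y, |σ x y| * (|f x - σ x y * f y| * (|f x| + |f y|))) / 2 := by
    simp only [signedVariation]
    rw [intervalIntegral.integral_div, intervalIntegral.integral_finsetSum fun x _ => hint3 x]
    refine div_le_div_of_nonneg_right (Finset.sum_le_sum fun x _ => ?_) (by norm_num)
    rw [intervalIntegral.integral_finsetSum fun y _ => hint2 x y]
    refine Finset.sum_le_sum fun y _ => ?_
    rcases hσ x y with h0 | h0
    · simp [h0]
    · rw [intervalIntegral.integral_const_mul]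
      exact mul_le_mul_of_nonneg_left (integral_abs_levelSign_sub_le f x y h0 (hM x) (hM y))
        (abs_nonneg _)
  have e3 : h * N ≤ (∑ x, ∑ y, |σ x y| * (|f x - σ x y * f y| * (|f x| + |f y|))) / 2 := by
    rw [← e1]
    refine (intervalIntegral.integral_mono_on hM0 ?_ ?_ fun t ht => hlevel t ht.1).trans e2
    · have := IntervalIntegrable.sum (Finset.univ) (fun x _ => hint1 x)
      simp only [Finset.sum_fn] at this
      exact this.const_mul _
    · have := IntervalIntegrable.sum (Finset.univ) (fun x _ => hint3 x)
      simp only [Finset.sum_fn] at this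
      exact this.div_const _
  -- Cauchy–Schwarz over ordered pairs separates the energy from a sum controlled by the degrees.
  have e4 : (∑ p : X × X, |σ p.1 p.2| * (|f p.1 - σ p.1 p.2 * f p.2| * (|f p.1| + |f p.2|))) ^ 2 ≤
      (∑ p : X × X, |σ p.1 p.2| * (f p.1 - σ p.1 p.2 * f p.2) ^ 2) *
      ∑ p : X × X, |σ p.1 p.2| * (|f p.1| + |f p.2|) ^ 2 := by
    refine Finset.sum_sq_le_sum_mul_sum_of_sq_le_mul _ (fun p _ => by positivity)
      (fun p _ => by positivity) fun p _ => le_of_eq ?_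
    rw [mul_pow, mul_pow, sq_abs (f p.1 - _)]
    ring
  simp only [Fintype.sum_prod_type] at e4
  have e5 : ∑ x, ∑ y, |σ x y| * (|f x| + |f y|) ^ 2 ≤ 4 * D * N := by
    have := sum_abs_mul_sq_add_sq hsymm hdeg f
    calc _ ≤ ∑ x, ∑ y, 2 * (|σ x y| * (f x ^ 2 + f y ^ 2)) := by
          refine Finset.sum_le_sum fun x _ => Finset.sum_le_sum fun y _ => ?_
          rw [← sq_abs (f x), ← sq_abs (f y)]
          nlinarith [mul_nonneg (abs_nonneg (σ x y)) (sq_nonneg (|f x| - |f y|))]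
      _ = 4 * D * N := by
          simp only [← Finset.mul_sum]
          rw [this]
          ring
  have hE : ∑ x, ∑ y, |σ x y| * (f x - σ x y * f y) ^ 2 = 2 * signedEnergy σ f := by
    unfold signedEnergy
    ring
  rw [hE] at e4
  have hE0 := signedEnergy_nonneg σ f
  set T := ∑ x, ∑ y, |σ x y| * (|f x - σ x y * f y| * (|f x| + |f y|))
  have e6 : (2 * (h * N)) ^ 2 ≤ 2 * signedEnergy σ f * (4 * D * N) :=
    (pow_le_pow_left₀ (by positivity) (by linarith) 2).trans
      (e4.trans (mul_le_mul_of_nonneg_left e5 (by positivity)))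
  rcases hN0.eq_or_lt with h0 | h0
  · rw [← h0]
    simpa using by positivity
  · have : (h ^ 2 * N) * N ≤ (2 * D * signedEnergy σ f) * N := by nlinarith
    exact le_of_mul_le_mul_right this h0

end SignedGraph

/-! ### Greedy merging of weights. -/

section Merging

variable {ι : Type*}

/-- Add one item at a time: if neither the old items nor the new one reach 1/2 alone, together they
stay below 1 ≤ b. -/
theorem exists_subset_half_le_sum [DecidableEq ι] {a : ι → ℝ} (P : Finset ι) {b : ℝ} (hb : 1 ≤ b)
    (hab : ∀ p ∈ P, a p ≤ b) (hP : 1 / 2 ≤ ∑ p ∈ P, a p) :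
    ∃ Q ⊆ P, 1 / 2 ≤ ∑ p ∈ Q, a p ∧ ∑ p ∈ Q, a p ≤ b := by
  induction P using Finset.induction_on with
  | empty => norm_num at hP
  | insert p P hp ih =>
    by_cases h1 : 1 / 2 ≤ ∑ p ∈ P, a p
    · obtain ⟨Q, hQ, h2⟩ := ih (fun q hq => hab q (Finset.mem_insert_of_mem hq)) h1
      exact ⟨Q, hQ.trans (Finset.subset_insert _ _), h2⟩
    by_cases h2 : 1 / 2 ≤ a p
    · exact ⟨{p}, by simp, by simpa using h2, by simpa using hab p (Finset.mem_insert_self _ _)⟩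
    · refine ⟨insert p P, subset_rfl, hP, ?_⟩
      rw [Finset.sum_insert hp]
      linarith

/-- Objects of weight at most `b` can be merged greedily into `j` groups of weight at least
`1 / 2`, if their total weight is at least `(j - 1) b + 1 / 2`. -/
theorem exists_groups_half_le_sum [DecidableEq ι] {a : ι → ℝ} {b : ℝ} (hb : 1 ≤ b) (j : ℕ)
    (P : Finset ι) (hab : ∀ p ∈ P, a p ≤ b) (hP : j * b + 1 / 2 ≤ ∑ p ∈ P, a p + b) :
    ∃ Q : Fin j → Finset ι, (∀ i, Q i ⊆ P) ∧ Pairwise (fun i i' => Disjoint (Q i) (Q i')) ∧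
      ∀ i, 1 / 2 ≤ ∑ p ∈ Q i, a p := by
  induction j generalizing P with
  | zero => exact ⟨fun i => i.elim0, fun i => i.elim0, fun i => i.elim0, fun i => i.elim0⟩
  | succ j ih =>
    push_cast at hP
    have hj : 0 ≤ (j : ℝ) * b := by positivity
    obtain ⟨Q, hQP, hQ1, hQ2⟩ := exists_subset_half_le_sum P hb hab (by linarith)
    have hsum := Finset.sum_sdiff (f := a) hQP
    obtain ⟨R, hR1, hR2, hR3⟩ := ih (P \ Q) (fun p hp => hab p (Finset.sdiff_subset hp))
      (by linarith)
    have hdisj : ∀ i, Disjoint Q (R i) := fun i =>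
      Finset.disjoint_of_subset_right (hR1 i) Finset.disjoint_sdiff
    refine ⟨Fin.cons Q R, Fin.cases hQP fun i => (hR1 i).trans Finset.sdiff_subset, ?_,
      Fin.cases hQ1 hR3⟩
    intro i i' hi
    induction i using Fin.cases with
    | zero =>
      induction i' using Fin.cases with
      | zero => exact absurd rfl hi
      | succ i' => exact hdisj i'
    | succ i =>
      induction i' using Fin.cases with
      | zero => exact (hdisj i).symm
      | succ i' => exact hR2 fun h => hi (congrArg Fin.succ h)

end Merging

/-! ### Ball carving in projective distance. -/

section Carving

variable {X E : Type*} [Fintype X] [NormedAddCommGroup E]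

open Classical in
/-- The points `x` for which `u x` or `-u x` lies in the ball of radius `r` around `c`. -/
noncomputable def projectiveBall (u : X → E) (c : E) (r : ℝ) : Finset X :=
  {x | ‖u x - c‖ < r ∨ ‖u x + c‖ < r}

theorem mem_projectiveBall {u : X → E} {c : E} {r : ℝ} {x : X} :
    x ∈ projectiveBall u c r ↔ ‖u x - c‖ < r ∨ ‖u x + c‖ < r := by
  simp [projectiveBall]

theorem projectiveBall_mono (u : X → E) (c : E) {r r' : ℝ} (h : r ≤ r') :
    projectiveBall u c r ⊆ projectiveBall u c r' := fun x hx => by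
  rw [mem_projectiveBall] at hx ⊢
  exact hx.imp (fun h1 => h1.trans_le h) fun h1 => h1.trans_le h

theorem projectiveBall_separated {u : X → E} {c : E} {r r' : ℝ} {x y : X}
    (hx : x ∈ projectiveBall u c r) (hy : y ∉ projectiveBall u c r') :
    r' - r ≤ ‖u x - u y‖ ∧ r' - r ≤ ‖u x + u y‖ := by
  rw [mem_projectiveBall] at hx hy
  push Not at hy
  obtain ⟨h1, h2⟩ := hy
  rcases hx with h | h
  · have h3 : ‖u y - c‖ ≤ ‖u x - c‖ + ‖u x - u y‖ := by
      rw [show u y - c = (u x - c) - (u x - u y) by abel]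
      exact norm_sub_le _ _
    have h4 : ‖u y + c‖ ≤ ‖u x + u y‖ + ‖u x - c‖ := by
      rw [show u y + c = (u x + u y) - (u x - c) by abel]
      exact norm_sub_le _ _
    constructor <;> linarith
  · have h3 : ‖u y - c‖ ≤ ‖u x + u y‖ + ‖u x + c‖ := by
      rw [show u y - c = (u x + u y) - (u x + c) by abel]
      exact norm_sub_le _ _
    have h4 : ‖u y + c‖ ≤ ‖u x + c‖ + ‖u x - u y‖ := by
      rw [show u y + c = (u x + c) - (u x - u y) by abel]
      exact norm_sub_le _ _
    constructor <;> linarith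

variable [InnerProductSpace ℝ E]

-- Since r < 1, the balls around the antipodal unit vectors u x and -u x are disjoint, so the
-- indicator of their union is a sum. This makes the weight an explicit function of the centre,
-- ready to be integrated.
open Classical in
theorem sum_inter_projectiveBall {u : X → E} (hu : ∀ x, ‖u x‖ = 1) (w : X → ℝ) (Y : Finset X)
    (c : E) {r : ℝ} (hr : r < 1) :
    ∑ x ∈ Y ∩ projectiveBall u c r, w x =
      ∑ x ∈ Y, w x * ((Metric.ball (u x) r).indicator 1 c +
        (Metric.ball (-u x) r).indicator 1 c) := by
  rw [← Finset.filter_mem_eq_inter, Finset.sum_filter]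
  refine Finset.sum_congr rfl fun x _ => ?_
  simp only [mem_projectiveBall, Set.indicator_apply, Metric.mem_ball, dist_eq_norm,
    norm_sub_rev c, Pi.one_apply]
  rw [show -u x - c = -(u x + c) by abel, norm_neg]
  by_cases h1 : ‖u x - c‖ < r <;> by_cases h2 : ‖u x + c‖ < r <;> simp [h1, h2]
  have h3 : ‖(2 : ℝ) • u x‖ ≤ ‖u x - c‖ + ‖u x + c‖ := by
    rw [show (2 : ℝ) • u x = (u x - c) + (u x + c) by rw [two_smul]; abel]
    exact norm_add_le _ _
  rw [norm_smul, hu] at h3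
  norm_num at h3
  linarith

/-- Test isotropy on v = c: every u x in the projective ball satisfies ⟨u x, c⟩² ≥ (1 - r²) ‖c‖². -/
theorem sum_le_of_subset_projectiveBall {u : X → E} (hu : ∀ x, ‖u x‖ = 1) {w : X → ℝ}
    (hw : ∀ x, 0 ≤ w x) (hiso : ∀ v : E, ∑ x, w x * inner ℝ (u x) v ^ 2 = ‖v‖ ^ 2)
    {S : Finset X} {c : E} {r : ℝ} (hr : r < 1) (hS : S ⊆ projectiveBall u c r) :
    (1 - r ^ 2) * ∑ x ∈ S, w x ≤ 1 := by
  rcases S.eq_empty_or_nonempty with rfl | ⟨x₀, hx₀⟩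
  · simp
  have hr0 : 0 < r := by
    rcases mem_projectiveBall.1 (hS hx₀) with h | h <;> exact (norm_nonneg _).trans_lt h
  have hc : 0 < ‖c‖ := by
    rcases mem_projectiveBall.1 (hS hx₀) with h | h
    · have := norm_sub_norm_le (u x₀) c
      rw [hu] at this
      linarith
    · have := norm_sub_norm_le (u x₀) (-c)
      rw [hu, norm_neg, sub_neg_eq_add] at this
      linarith
  have key : ∀ x ∈ S, (1 - r ^ 2) * ‖c‖ ^ 2 ≤ inner ℝ (u x) c ^ 2 := fun x hx => by
    have h1 : 0 ≤ 1 - r ^ 2 := by nlinarith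
    rcases mem_projectiveBall.1 (hS hx) with h | h
    · have h2 := norm_sub_sq_real (u x) c
      rw [hu] at h2
      have h3 : ‖u x - c‖ ^ 2 < r ^ 2 := pow_lt_pow_left₀ h (norm_nonneg _) two_ne_zero
      -- Squaring this and using (p + q)² ≥ 4pq with p = 1 - r², q = ‖c‖² gives the bound.
      have h4 : 1 - r ^ 2 + ‖c‖ ^ 2 ≤ 2 * inner ℝ (u x) c := by linarith
      have h5 := pow_le_pow_left₀ (by positivity) h4 2
      nlinarith [sq_nonneg (1 - r ^ 2 - ‖c‖ ^ 2)]
    · have h2 := norm_add_sq_real (u x) c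
      rw [hu] at h2
      have h3 : ‖u x + c‖ ^ 2 < r ^ 2 := pow_lt_pow_left₀ h (norm_nonneg _) two_ne_zero
      have h4 : 1 - r ^ 2 + ‖c‖ ^ 2 ≤ -(2 * inner ℝ (u x) c) := by linarith
      have h5 := pow_le_pow_left₀ (by positivity) h4 2
      nlinarith [sq_nonneg (1 - r ^ 2 - ‖c‖ ^ 2)]
  have h1 : ((1 - r ^ 2) * ∑ x ∈ S, w x) * ‖c‖ ^ 2 ≤ 1 * ‖c‖ ^ 2 := by
    calc ((1 - r ^ 2) * ∑ x ∈ S, w x) * ‖c‖ ^ 2 = ∑ x ∈ S, w x * ((1 - r ^ 2) * ‖c‖ ^ 2) := by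
          rw [← Finset.sum_mul]
          ring
      _ ≤ ∑ x ∈ S, w x * inner ℝ (u x) c ^ 2 :=
          Finset.sum_le_sum fun x hx => mul_le_mul_of_nonneg_left (key x hx) (hw x)
      _ ≤ ∑ x, w x * inner ℝ (u x) c ^ 2 :=
          Finset.sum_le_sum_of_subset_of_nonneg (Finset.subset_univ _)
            fun x _ _ => mul_nonneg (hw x) (sq_nonneg _)
      _ = 1 * ‖c‖ ^ 2 := by rw [hiso c, one_mul]
  exact le_of_mul_le_mul_right h1 (by positivity)

variable [FiniteDimensional ℝ E] [MeasurableSpace E] [BorelSpace E]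

omit [Fintype X] in
open MeasureTheory in
theorem integrable_sum_indicator_ball (u : X → E) (w : X → ℝ) (Y : Finset X) (r : ℝ) :
    Integrable (fun c => ∑ x ∈ Y, w x * ((Metric.ball (u x) r).indicator (1 : E → ℝ) c +
        (Metric.ball (-u x) r).indicator 1 c)) volume := by
  have h : ∀ z : E, Integrable ((Metric.ball z r).indicator (1 : E → ℝ)) volume := fun z =>
    (integrable_indicator_iff measurableSet_ball).2
      (integrableOn_const (C := (1 : ℝ)) measure_ball_lt_top.ne)
  exact integrable_finsetSum _ fun x _ => ((h _).add (h _)).const_mul _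

omit [Fintype X] in
open MeasureTheory in
theorem integral_sum_indicator_ball (u : X → E) (w : X → ℝ) (Y : Finset X) {r : ℝ} (hr : 0 < r) :
    ∫ c, ∑ x ∈ Y, w x * ((Metric.ball (u x) r).indicator (1 : E → ℝ) c +
        (Metric.ball (-u x) r).indicator 1 c) =
      r ^ Module.finrank ℝ E * (2 * volume.real (Metric.ball (0 : E) 1) * ∑ x ∈ Y, w x) := by
  have h : ∀ z : E, Integrable ((Metric.ball z r).indicator (1 : E → ℝ)) volume := fun z =>
    (integrable_indicator_iff measurableSet_ball).2
      (integrableOn_const (C := (1 : ℝ)) measure_ball_lt_top.ne)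
  have h2 : ∀ z : E, ∫ c, (Metric.ball z r).indicator (1 : E → ℝ) c =
      r ^ Module.finrank ℝ E * volume.real (Metric.ball (0 : E) 1) := fun z => by
    rw [integral_indicator_one measurableSet_ball, measureReal_def, measureReal_def,
      Measure.addHaar_ball_of_pos _ _ hr, ENNReal.toReal_mul, ENNReal.toReal_ofReal (by positivity)]
  have h3 : ∀ x, Integrable (fun c => w x * ((Metric.ball (u x) r).indicator (1 : E → ℝ) c +
      (Metric.ball (-u x) r).indicator 1 c)) volume := fun x => ((h _).add (h _)).const_mul _
  rw [integral_finsetSum _ fun x _ => h3 x]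
  simp only [integral_const_mul]
  rw [Finset.mul_sum, Finset.mul_sum]
  refine Finset.sum_congr rfl fun x _ => ?_
  rw [integral_add (h _) (h _), h2, h2]
  ring

-- Averaging over centres: by translation invariance and scaling of volume, the integral of the
-- weight in the ball of radius r is (r / r')^n times that for radius r', so some centre does at
-- least as well as the average.
open Classical MeasureTheory in
theorem exists_projectiveBall_pow_mul_le {u : X → E} (hu : ∀ x, ‖u x‖ = 1) {w : X → ℝ}
    (hw : ∀ x, 0 ≤ w x) {Y : Finset X} (hY : 0 < ∑ x ∈ Y, w x) {r r' : ℝ} (hr : 0 < r)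
    (hrr' : r ≤ r') (hr' : r' < 1) :
    ∃ c : E, 0 < ∑ x ∈ Y ∩ projectiveBall u c r', w x ∧
      (r / r') ^ Module.finrank ℝ E * ∑ x ∈ Y ∩ projectiveBall u c r', w x ≤
        ∑ x ∈ Y ∩ projectiveBall u c r, w x := by
  by_contra! hcon
  set W : ℝ → E → ℝ := fun r c => ∑ x ∈ Y ∩ projectiveBall u c r, w x with hW
  have hpos : 0 < r' := hr.trans_le hrr'
  have hW0 : ∀ s c, 0 ≤ W s c := fun s c => Finset.sum_nonneg fun x _ => hw x
  have hmono : ∀ c, W r c ≤ W r' c := fun c => Finset.sum_le_sum_of_subset_of_nonneg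
    (Finset.inter_subset_inter_left (projectiveBall_mono u c hrr')) fun x _ _ => hw x
  have hWint : ∀ s < 1, W s = fun c => ∑ x ∈ Y, w x * ((Metric.ball (u x) s).indicator 1 c +
        (Metric.ball (-u x) s).indicator 1 c) := fun s hs => by
    ext c
    exact sum_inter_projectiveBall hu w Y c hs
  have hr1 := hrr'.trans_lt hr'
  set q := (r / r') ^ Module.finrank ℝ E with hq
  have hq0 : 0 < q := by positivity
  have hi : Integrable (W r) volume := by
    rw [hWint r hr1]
    exact integrable_sum_indicator_ball u w Y r
  have hi' : Integrable (W r') volume := by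
    rw [hWint r' hr']
    exact integrable_sum_indicator_ball u w Y r'
  have hI : ∫ c, (q * W r' c - W r c) = 0 := by
    rw [integral_sub (hi'.const_mul _) hi, integral_const_mul, hWint r hr1, hWint r' hr',
      integral_sum_indicator_ball u w Y hr, integral_sum_indicator_ball u w Y hpos, hq, div_pow]
    field_simp
    ring
  -- Under the negated claim the integrand of `hI` is nonnegative (where W r' vanishes, so does W r)
  -- and strictly positive where W r' > 0. Its integral being 0, W r' vanishes almost everywhere,
  -- contradicting `hY`.
  have hle : ∀ c, 0 ≤ q * W r' c - W r c := fun c => by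
    rcases (hW0 r' c).eq_or_lt with h | h
    · have := hmono c
      rw [← h]
      linarith
    · exact sub_nonneg.2 (hcon c h).le
  rw [integral_eq_zero_iff_of_nonneg hle ((hi'.const_mul _).sub hi)] at hI
  have h0 : W r' =ᵐ[volume] 0 := by
    filter_upwards [hI] with c hc
    by_contra h
    have h1 := hcon c (lt_of_le_of_ne (hW0 r' c) (Ne.symm h))
    have h2 : q * W r' c - W r c = 0 := hc
    change W r c < q * W r' c at h1
    linarith
  have h1 := integral_congr_ae h0
  rw [hWint r' hr', integral_sum_indicator_ball u w Y hpos] at h1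
  have h2 : 0 < volume.real (Metric.ball (0 : E) 1) :=
    ENNReal.toReal_pos (Metric.measure_ball_pos _ _ one_pos).ne' measure_ball_lt_top.ne
  have h3 : 0 < r' ^ Module.finrank ℝ E *
      (2 * volume.real (Metric.ball (0 : E) 1) * ∑ x ∈ Y, w x) := by positivity
  simp at h1
  rcases h1 with h1 | h1 | h1
  · exact absurd h1.1 hpos.ne'
  · exact absurd h1 h2.ne'
  · exact absurd h1 hY.ne'

open Classical in
/-- Ball carving: all but a fraction `1 - (r / r')^n` of the weight is covered by pieces of
radius `r` that are `r' - r` apart. -/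
theorem exists_separated_pieces {u : X → E} (hu : ∀ x, ‖u x‖ = 1) {w : X → ℝ}
    (hw : ∀ x, 0 ≤ w x) {r r' : ℝ} (hr : 0 < r) (hrr' : r ≤ r') (hr' : r' < 1) (Y : Finset X) :
    ∃ P : Finset (Finset X), (∀ S ∈ P, S ⊆ Y ∧ ∃ c, S ⊆ projectiveBall u c r) ∧
      (∀ S ∈ P, ∀ T ∈ P, S ≠ T → Disjoint S T ∧
        ∀ x ∈ S, ∀ y ∈ T, r' - r ≤ ‖u x - u y‖ ∧ r' - r ≤ ‖u x + u y‖) ∧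
      (r / r') ^ Module.finrank ℝ E * ∑ x ∈ Y, w x ≤ ∑ S ∈ P, ∑ x ∈ S, w x := by
  induction Y using Finset.strongInduction with
  | H Y ih =>
    rcases (Finset.sum_nonneg fun x (_ : x ∈ Y) => hw x).eq_or_lt with hY | hY
    · exact ⟨∅, by simp, by simp, by simp [← hY]⟩
    -- Keep the part of Y in the inner ball, discard the shell between the two radii, and recurse
    -- outside the outer ball. The shell guarantees the separation.
    obtain ⟨c, hc1, hc2⟩ := exists_projectiveBall_pow_mul_le hu hw hY hr hrr' hr'
    have hpos : 0 < r' := hr.trans_le hrr'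
    set B := projectiveBall u c r'
    set S := Y ∩ projectiveBall u c r with hS
    have hSpos : 0 < ∑ x ∈ S, w x := lt_of_lt_of_le (by positivity) hc2
    have hSB : S ⊆ B := Finset.inter_subset_right.trans (projectiveBall_mono u c hrr')
    have hss : Y \ B ⊂ Y := by
      obtain ⟨x, hx⟩ : (Y ∩ B).Nonempty := by
        rw [Finset.nonempty_iff_ne_empty]
        intro h
        rw [h] at hc1
        simp at hc1
      rw [Finset.mem_inter] at hx
      exact ⟨Finset.sdiff_subset, fun h => (Finset.mem_sdiff.1 (h hx.1)).2 hx.2⟩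
    obtain ⟨P, hP1, hP2, hP3⟩ := ih _ hss
    have hdisj : ∀ T ∈ P, Disjoint S T := fun T hT =>
      Finset.disjoint_of_subset_left hSB
        (Finset.disjoint_of_subset_right (hP1 T hT).1 Finset.disjoint_sdiff)
    have hsep : ∀ T ∈ P, ∀ x ∈ S, ∀ y ∈ T,
        r' - r ≤ ‖u x - u y‖ ∧ r' - r ≤ ‖u x + u y‖ := fun T hT x hx y hy =>
      projectiveBall_separated (Finset.inter_subset_right hx)
        (Finset.mem_sdiff.1 ((hP1 T hT).1 hy)).2
    have hSP : S ∉ P := fun h => by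
      rw [disjoint_self.1 (hdisj S h)] at hSpos
      simp at hSpos
    refine ⟨insert S P, ?_, ?_, ?_⟩
    · intro T hT
      rcases Finset.mem_insert.1 hT with rfl | hT
      · exact ⟨Finset.inter_subset_left, c, Finset.inter_subset_right⟩
      · exact ⟨(hP1 T hT).1.trans Finset.sdiff_subset, (hP1 T hT).2⟩
    · intro T hT T' hT' hne
      rcases Finset.mem_insert.1 hT with rfl | hT <;>
        rcases Finset.mem_insert.1 hT' with rfl | hT'
      · exact absurd rfl hne
      · exact ⟨hdisj T' hT', hsep T' hT'⟩
      · refine ⟨(hdisj T hT).symm, fun x hx y hy => ?_⟩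
        rw [norm_sub_rev, add_comm]
        exact hsep T hT y hy x hx
      · exact hP2 T hT T' hT' hne
    · rw [Finset.sum_insert hSP, ← Finset.sum_inter_add_sum_sdiff Y B, mul_add]
      exact add_le_add hc2 hP3

-- This is the trace of the isotropy identity, since the squared coordinates of a unit vector sum to
-- 1.
omit [FiniteDimensional ℝ E] [MeasurableSpace E] [BorelSpace E] in
theorem sum_eq_card_of_isotropic {u : X → E} (hu : ∀ x, ‖u x‖ = 1) {w : X → ℝ}
    (hiso : ∀ v : E, ∑ x, w x * inner ℝ (u x) v ^ 2 = ‖v‖ ^ 2) {ι : Type*} [Fintype ι]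
    (e : OrthonormalBasis ι ℝ E) : ∑ x, w x = Fintype.card ι := by
  have h : ∀ x, ∑ i, inner ℝ (u x) (e i) ^ 2 = 1 := fun x => by
    have := e.sum_sq_norm_inner_left (u x)
    simpa [hu] using this
  calc ∑ x, w x = ∑ x, w x * ∑ i, inner ℝ (u x) (e i) ^ 2 := by simp [h]
    _ = ∑ i, ∑ x, w x * inner ℝ (u x) (e i) ^ 2 := by
      simp only [Finset.mul_sum]
      exact Finset.sum_comm
    _ = Fintype.card ι := by simp [hiso]

open Classical in
/-- An isotropic weighted family of unit vectors of `ℝ^k` contains `k` groups of weight at least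
`1 / 2` that are `2 δ` apart up to sign, where `δ⁻² = 512 k⁵`. -/
theorem exists_separated_groups {k : ℕ} (hk : 1 ≤ k) {u : X → EuclideanSpace ℝ (Fin k)}
    (hu : ∀ x, ‖u x‖ = 1) {w : X → ℝ} (hw : ∀ x, 0 ≤ w x)
    (hiso : ∀ v, ∑ x, w x * inner ℝ (u x) v ^ 2 = ‖v‖ ^ 2) {δ : ℝ} (hδ : 0 < δ)
    (hδk : δ ^ 2 * (512 * k ^ 5) = 1) :
    ∃ G : Fin k → Finset X, (∀ i, 1 / 2 ≤ ∑ x ∈ G i, w x) ∧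
      ∀ i j, i ≠ j → ∀ x ∈ G i, ∀ y ∈ G j, 2 * δ ≤ ‖u x - u y‖ ∧ 2 * δ ≤ ‖u x + u y‖ := by
  have hk1 : (1 : ℝ) ≤ k := by exact_mod_cast hk
  -- With this radius r² = 1 / (8k), so a piece weighs at most 1 + 1 / (4k). Also r / (r + 2δ) = 1 -
  -- 1 / (4k² + 1), whose k-th power is at least 1 - 1 / (4k) by Bernoulli, so the shells lose at
  -- most 1/4 of the total weight k.
  set r := 8 * (k : ℝ) ^ 2 * δ with hr
  have hr0 : 0 < r := by positivity
  have hr2 : r ^ 2 * (8 * k) = 1 := by rw [← hδk, hr]; ring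
  have hr1 : r < 1 / 2 := by
    by_contra! h
    have : (1 / 2 : ℝ) ^ 2 ≤ r ^ 2 := pow_le_pow_left₀ (by norm_num) h 2
    nlinarith
  have hδr : 2 * δ ≤ r := by
    rw [hr]
    have : (1 : ℝ) ≤ (k : ℝ) ^ 2 := one_le_pow₀ hk1
    nlinarith
  obtain ⟨P, hP1, hP2, hP3⟩ := exists_separated_pieces hu hw hr0 (r' := r + 2 * δ) (by linarith)
    (by linarith) Finset.univ
  rw [sum_eq_card_of_isotropic hu hiso (EuclideanSpace.basisFun (Fin k) ℝ), finrank_euclideanSpace,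
    Fintype.card_fin] at hP3
  have hq : 1 - 1 / (4 * (k : ℝ)) ≤ (r / (r + 2 * δ)) ^ k := by
    have h1 : r / (r + 2 * δ) = 1 + -(1 / (4 * (k : ℝ) ^ 2 + 1)) := by
      rw [hr]
      field_simp
      ring
    have h3 : 1 / (4 * (k : ℝ) ^ 2 + 1) ≤ 1 := by
      rw [div_le_one (by positivity)]
      nlinarith
    have h2 := one_add_mul_le_pow (a := -(1 / (4 * (k : ℝ) ^ 2 + 1))) (by linarith) k
    rw [h1]
    refine le_trans ?_ h2
    have h4 : (k : ℝ) * (1 / (4 * (k : ℝ) ^ 2 + 1)) ≤ 1 / (4 * (k : ℝ)) := by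
      rw [mul_one_div, div_le_div_iff₀ (by positivity) (by positivity)]
      nlinarith
    linarith
  have hP4 : (k : ℝ) - 1 / 4 ≤ ∑ S ∈ P, ∑ x ∈ S, w x := by
    refine le_trans ?_ hP3
    have h1 := mul_le_mul_of_nonneg_right hq (Nat.cast_nonneg k)
    have h2 : (1 - 1 / (4 * (k : ℝ))) * k = k - 1 / 4 := by
      field_simp
    linarith
  have hmass : ∀ S ∈ P, ∑ x ∈ S, w x ≤ 1 + 1 / (4 * (k : ℝ)) := fun S hS => by
    obtain ⟨c, hc⟩ := (hP1 S hS).2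
    have h1 := sum_le_of_subset_projectiveBall hu hw hiso (by linarith) hc
    have h2 : r ^ 2 = 1 / (8 * k) := by
      rw [eq_div_iff (by positivity), hr2]
    rw [h2] at h1
    have h3 : 0 < 1 - 1 / (8 * (k : ℝ)) := by
      rw [sub_pos, div_lt_one (by positivity)]
      linarith
    have h4 : 1 ≤ (1 - 1 / (8 * (k : ℝ))) * (1 + 1 / (4 * (k : ℝ))) := by
      have : (1 - 1 / (8 * (k : ℝ))) * (1 + 1 / (4 * (k : ℝ))) =
        1 + (4 * k - 1) / (32 * (k : ℝ) ^ 2) := by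
        field_simp
        ring
      rw [this]
      have : 0 ≤ (4 * (k : ℝ) - 1) / (32 * (k : ℝ) ^ 2) :=
        div_nonneg (by linarith) (by positivity)
      linarith
    exact le_of_mul_le_mul_left (h1.trans h4) h3
  -- The budget suffices: with b = 1 + 1 / (4k), (k - 1) b + 1/2 = k - 1/4 - 1 / (4k), and the
  -- pieces weigh at least k - 1/4.
  obtain ⟨Q, hQ1, hQ2, hQ3⟩ := exists_groups_half_le_sum (a := fun S => ∑ x ∈ S, w x)
    (b := 1 + 1 / (4 * (k : ℝ))) (by simp) k P hmass (by
      have h1 : (k : ℝ) * (1 + 1 / (4 * (k : ℝ))) = k + 1 / 4 := by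
        field_simp
      have h2 : 0 ≤ 1 / (4 * (k : ℝ)) := by positivity
      rw [h1]
      linarith)
  refine ⟨fun i => (Q i).biUnion id, fun i => ?_, fun i j hij x hx y hy => ?_⟩
  · rw [Finset.sum_biUnion]
    · exact hQ3 i
    · intro S hS T hT hST
      exact (hP2 S (hQ1 i hS) T (hQ1 i hT) hST).1
  · obtain ⟨S, hS, hxS⟩ := Finset.mem_biUnion.1 hx
    obtain ⟨T, hT, hyT⟩ := Finset.mem_biUnion.1 hy
    have hne : S ≠ T := fun h => Finset.disjoint_left.1 (hQ2 hij) hS (h ▸ hT)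
    have := (hP2 S (hQ1 i hS) T (hQ1 j hT) hne).2 x hxS y hyT
    rwa [add_sub_cancel_left] at this

end Carving

/-! ### Cutoff functions of the direction. -/

section Bump

variable {E : Type*} [NormedAddCommGroup E]

/-- The cutoff function `1 - dist(z, T) / δ`, truncated at `0`. -/
noncomputable def bump (T : Set E) (δ : ℝ) (z : E) : ℝ := max 0 (1 - Metric.infDist z T / δ)

theorem bump_nonneg (T : Set E) (δ : ℝ) (z : E) : 0 ≤ bump T δ z := le_max_left _ _

theorem bump_le_one (T : Set E) {δ : ℝ} (hδ : 0 < δ) (z : E) : bump T δ z ≤ 1 :=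
  max_le zero_le_one (by
    have : 0 ≤ Metric.infDist z T / δ := div_nonneg Metric.infDist_nonneg hδ.le
    linarith)

theorem bump_of_mem {T : Set E} (δ : ℝ) {z : E} (hz : z ∈ T) : bump T δ z = 1 := by
  simp [bump, Metric.infDist_zero_of_mem hz]

/-- Negation is an isometry preserving T. Evenness is what makes the cutoff compatible with edges of
negative sign. -/
theorem bump_neg {T : Set E} (hT : ∀ z, z ∈ T ↔ -z ∈ T) (δ : ℝ) (z : E) :
    bump T δ (-z) = bump T δ z := by
  unfold bump
  congr 3
  have himg : Neg.neg '' T = T := by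
    ext a
    rw [Set.image_neg_eq_neg, Set.mem_neg, ← hT]
  conv_lhs => rw [← himg]
  exact Metric.infDist_image (IsometryEquiv.neg E).isometry

theorem abs_bump_sub_le (T : Set E) {δ : ℝ} (hδ : 0 < δ) (z z' : E) :
    |bump T δ z - bump T δ z'| ≤ ‖z - z'‖ / δ := by
  unfold bump
  refine (abs_max_sub_max_le_max _ _ _ _).trans (max_le (by simp; positivity) ?_)
  rw [show 1 - Metric.infDist z T / δ - (1 - Metric.infDist z' T / δ) =
    (Metric.infDist z' T - Metric.infDist z T) / δ by ring, abs_div, abs_of_pos hδ]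
  refine div_le_div_of_nonneg_right ?_ hδ.le
  have h1 := Metric.infDist_le_infDist_add_dist (s := T) (x := z) (y := z')
  have h2 := Metric.infDist_le_infDist_add_dist (s := T) (x := z') (y := z)
  rw [dist_comm z' z] at h2
  rw [← dist_eq_norm, abs_le]
  constructor <;> linarith

theorem exists_dist_lt_of_bump_ne_zero {T : Set E} (hT : T.Nonempty) {δ : ℝ} (hδ : 0 < δ) {z : E}
    (hz : bump T δ z ≠ 0) : ∃ a ∈ T, dist z a < δ := by
  rw [← Metric.infDist_lt_iff hT]
  by_contra! h
  refine hz (max_eq_left ?_)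
  rw [sub_nonpos, le_div_iff₀ hδ, one_mul]
  exact h

variable [NormedSpace ℝ E]

/-- Multiplying a vector-valued function by a cutoff of its direction increases the variation along
an edge of sign `s` at most by the factor `1 + 2 / δ`. -/
theorem norm_bump_smul_sub_le {T : Set E} (hT : ∀ z, z ∈ T ↔ -z ∈ T) {δ : ℝ} (hδ : 0 < δ)
    {a b u v : E} (hu : ‖u‖ = 1) (ha : a = ‖a‖ • u) (hb : b = ‖b‖ • v) {s : ℝ}
    (hs : s = 1 ∨ s = -1) :
    ‖bump T δ u • a - s • bump T δ v • b‖ ≤ (1 + 2 / δ) * ‖a - s • b‖ := by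
  have hss : |s| = 1 := by rcases hs with rfl | rfl <;> simp
  have hv : bump T δ v = bump T δ (s • v) := by
    rcases hs with rfl | rfl
    · simp
    · simp [bump_neg hT]
  -- The change of direction, scaled by ‖b‖, is controlled by the change of the vector: replacing a
  -- by ‖b‖ u costs |‖b‖ - ‖a‖| ≤ ‖a - s b‖.
  have h1 : ‖b‖ * ‖u - s • v‖ ≤ 2 * ‖a - s • b‖ := by
    have e : ‖b‖ * ‖u - s • v‖ = ‖(‖b‖ - ‖a‖) • u + (a - s • b)‖ := by
      rw [← norm_smul_of_nonneg (norm_nonneg b)]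
      congr 1
      conv_rhs => rw [sub_smul, ← ha]
      conv_rhs => rw [hb, norm_smul, norm_norm]
      have : ‖b‖ * ‖v‖ = ‖b‖ := by
        conv_rhs => rw [hb, norm_smul, norm_norm]
      rw [this, smul_sub, smul_comm]
      abel
    have h2 : |‖b‖ - ‖a‖| ≤ ‖a - s • b‖ := by
      have := abs_norm_sub_norm_le (s • b) a
      rwa [norm_smul, Real.norm_eq_abs, hss, one_mul, norm_sub_rev] at this
    rw [e]
    refine (norm_add_le _ _).trans ?_
    rw [norm_smul, hu, mul_one, Real.norm_eq_abs]
    linarith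
  -- A discrete product rule: the first term is bounded because the cutoff is at most 1, the second
  -- because it is 1/δ-Lipschitz.
  have h2 : bump T δ u • a - s • bump T δ v • b =
      bump T δ u • (a - s • b) + (bump T δ u - bump T δ v) • s • b := by
    rw [smul_sub, sub_smul, smul_comm s (bump T δ v)]
    abel
  rw [h2]
  refine (norm_add_le _ _).trans ?_
  rw [norm_smul, norm_smul, norm_smul, Real.norm_eq_abs, Real.norm_eq_abs, Real.norm_eq_abs, hss,
    one_mul, abs_of_nonneg (bump_nonneg _ _ _), hv]
  have h3 := mul_le_mul_of_nonneg_right (bump_le_one T hδ u) (norm_nonneg (a - s • b))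
  have h4 := mul_le_mul_of_nonneg_right (abs_bump_sub_le T hδ u (s • v)) (norm_nonneg b)
  have h5 : ‖u - s • v‖ / δ * ‖b‖ ≤ 2 / δ * ‖a - s • b‖ := by
    rw [div_mul_eq_mul_div, div_mul_eq_mul_div]
    exact div_le_div_of_nonneg_right (by linarith) hδ.le
  linarith

end Bump

/-! ### From orthonormal functions to disjointly supported ones. -/

section Localization

variable {X : Type*}

theorem exists_unit_direction {k : ℕ} (hk : 1 ≤ k) (F : X → EuclideanSpace ℝ (Fin k)) :
    ∃ u : X → EuclideanSpace ℝ (Fin k), (∀ x, ‖u x‖ = 1) ∧ ∀ x, F x = ‖F x‖ • u x := by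
  have h : ∀ x, ∃ v : EuclideanSpace ℝ (Fin k), ‖v‖ = 1 ∧ F x = ‖F x‖ • v := fun x => by
    by_cases hx : F x = 0
    · exact ⟨EuclideanSpace.single ⟨0, hk⟩ 1, by simp, by simp [hx]⟩
    · have : ‖F x‖ ≠ 0 := norm_ne_zero_iff.2 hx
      exact ⟨‖F x‖⁻¹ • F x, by simp [norm_smul, this], by rw [smul_inv_smul₀ this]⟩
  choose u hu using h
  exact ⟨u, fun x => (hu x).1, fun x => (hu x).2⟩

variable [Fintype X]

theorem sum_signedEnergy {k : ℕ} (σ : X → X → ℝ) (F : X → EuclideanSpace ℝ (Fin k)) :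
    ∑ j, signedEnergy σ (fun x => F x j) =
      (∑ x, ∑ y, |σ x y| * ‖F x - σ x y • F y‖ ^ 2) / 2 := by
  unfold signedEnergy
  rw [← Finset.sum_div, Finset.sum_comm]
  congr 1
  refine Finset.sum_congr rfl fun x _ => ?_
  rw [Finset.sum_comm]
  refine Finset.sum_congr rfl fun y _ => ?_
  rw [← Finset.mul_sum, EuclideanSpace.real_norm_sq_eq]
  simp

/-- Localization: from `k` orthonormal functions of energy at most `μ` one obtains `k` disjointly
supported functions whose Rayleigh quotients are at most `9216 k⁶ μ`. -/
theorem exists_disjoint_support_signedEnergy_le {σ : X → X → ℝ}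
    (hσ : ∀ x y, σ x y = 0 ∨ σ x y = 1 ∨ σ x y = -1) {m : X → ℝ} (hm : ∀ x, 0 ≤ m x)
    {k : ℕ} (hk : 1 ≤ k) {f : Fin k → X → ℝ}
    (hf : ∀ i j, ∑ x, m x * (f i x * f j x) = if i = j then 1 else 0) {μ : ℝ}
    (hμ : ∀ i, signedEnergy σ (f i) ≤ μ) :
    ∃ ψ : Fin k → X → ℝ, (∀ i j, i ≠ j → ∀ x, ψ i x = 0 ∨ ψ j x = 0) ∧
      (∀ i, 0 < ∑ x, m x * ψ i x ^ 2) ∧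
      ∀ i, signedEnergy σ (ψ i) ≤ 9216 * k ^ 6 * μ * ∑ x, m x * ψ i x ^ 2 := by
  have hk1 : (1 : ℝ) ≤ k := by exact_mod_cast hk
  set F : X → EuclideanSpace ℝ (Fin k) := fun x => WithLp.toLp 2 fun i => f i x with hF
  obtain ⟨u, hu, hFu⟩ := exists_unit_direction hk F
  have hμ0 : 0 ≤ μ := (signedEnergy_nonneg σ _).trans (hμ ⟨0, hk⟩)
  -- Orthonormality of the f i is exactly isotropy of the directions u x with weights m x ‖F x‖².
  have hiso : ∀ v, ∑ x, (m x * ‖F x‖ ^ 2) * inner ℝ (u x) v ^ 2 = ‖v‖ ^ 2 := fun v => by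
    have h1 : ∀ x, (m x * ‖F x‖ ^ 2) * inner ℝ (u x) v ^ 2 =
        ∑ i, ∑ j, (v i * v j) * (m x * (f i x * f j x)) := fun x => by
      have : ‖F x‖ * inner ℝ (u x) v = ∑ i, v i * f i x := by
        rw [← real_inner_smul_left, ← hFu, PiLp.inner_apply]
        simp [hF]
      rw [mul_assoc, ← mul_pow, this, sq, Finset.sum_mul_sum, Finset.mul_sum]
      refine Finset.sum_congr rfl fun i _ => ?_
      rw [Finset.mul_sum]
      exact Finset.sum_congr rfl fun j _ => by ring
    simp only [h1]
    rw [Finset.sum_comm, EuclideanSpace.real_norm_sq_eq]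
    refine Finset.sum_congr rfl fun i _ => ?_
    rw [Finset.sum_comm]
    simp only [← Finset.mul_sum, hf]
    simp [sq]
  set δ : ℝ := (Real.sqrt (512 * k ^ 5))⁻¹ with hδdef
  have hδ : 0 < δ := by positivity
  have hδk : δ ^ 2 * (512 * k ^ 5) = 1 := by
    rw [hδdef, inv_pow, Real.sq_sqrt (by positivity), inv_mul_cancel₀ (by positivity)]
  have hδ1 : δ ≤ 1 := by
    by_contra! h
    have h1 : 1 ≤ δ ^ 2 := one_le_pow₀ h.le
    have h2 : (1 : ℝ) ≤ (k : ℝ) ^ 5 := one_le_pow₀ hk1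
    nlinarith
  obtain ⟨G, hG1, hG2⟩ := exists_separated_groups hk hu
    (fun x => mul_nonneg (hm x) (sq_nonneg ‖F x‖)) hiso hδ hδk
  set T : Fin k → Set (EuclideanSpace ℝ (Fin k)) := fun i => {z | ∃ y ∈ G i, z = u y ∨ z = -u y}
  have hTneg : ∀ i z, z ∈ T i ↔ -z ∈ T i := fun i z => by
    refine exists_congr fun y => and_congr_right fun _ => ?_
    rw [neg_eq_iff_eq_neg, neg_inj, or_comm]
  have hTne : ∀ i, (T i).Nonempty := fun i => by
    have : (G i).Nonempty := by
      rw [Finset.nonempty_iff_ne_empty]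
      intro h
      have := hG1 i
      rw [h] at this
      norm_num at this
    obtain ⟨y, hy⟩ := this
    exact ⟨u y, y, hy, Or.inl rfl⟩
  set θ : Fin k → X → ℝ := fun i x => bump (T i) δ (u x) with hθ
  have hdisj : ∀ i j, i ≠ j → ∀ x, θ i x = 0 ∨ θ j x = 0 := fun i j hij x => by
    by_contra! h
    obtain ⟨a, ⟨y, hy, ha⟩, hxa⟩ := exists_dist_lt_of_bump_ne_zero (hTne i) hδ h.1
    obtain ⟨b, ⟨z, hz, hb⟩, hxb⟩ := exists_dist_lt_of_bump_ne_zero (hTne j) hδ h.2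
    have h1 : ‖a - b‖ < 2 * δ := by
      rw [← dist_eq_norm]
      have := dist_triangle_left a b (u x)
      linarith
    obtain ⟨h2, h3⟩ := hG2 i j hij y hy z hz
    rcases ha with rfl | rfl <;> rcases hb with rfl | rfl
    · linarith
    · rw [sub_neg_eq_add] at h1
      linarith
    · rw [← norm_neg, neg_sub, sub_neg_eq_add, add_comm] at h1
      linarith
    · rw [← norm_neg, neg_sub, sub_neg_eq_add, neg_add_eq_sub] at h1
      linarith
  -- Averaging over the coordinates j of θ i • F: the total energy is at most (3/δ)² k μ = 4608 k⁶ μ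
  -- and the total mass at least 1/2, so some coordinate of positive mass has quotient at most 9216
  -- k⁶ μ.
  have hpick : ∀ i, ∃ j, 0 < ∑ x, m x * (θ i x * f j x) ^ 2 ∧
      signedEnergy σ (fun x => θ i x * f j x) ≤
        9216 * k ^ 6 * μ * ∑ x, m x * (θ i x * f j x) ^ 2 := fun i => by
    have hE : ∑ j, signedEnergy σ (fun x => θ i x * f j x) ≤ 4608 * k ^ 6 * μ := by
      have e1 := sum_signedEnergy σ (fun x => θ i x • F x)
      have e2 := sum_signedEnergy σ F
      have e3 : (∑ x, ∑ y, |σ x y| * ‖θ i x • F x - σ x y • θ i y • F y‖ ^ 2) / 2 ≤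
          (3 / δ) ^ 2 * ((∑ x, ∑ y, |σ x y| * ‖F x - σ x y • F y‖ ^ 2) / 2) := by
        rw [← mul_div_assoc, Finset.mul_sum]
        refine div_le_div_of_nonneg_right (Finset.sum_le_sum fun x _ => ?_) (by norm_num)
        rw [Finset.mul_sum]
        refine Finset.sum_le_sum fun y _ => ?_
        rcases hσ x y with h0 | h0
        · simp [h0]
        have h1 := norm_bump_smul_sub_le (hTneg i) hδ (hu x) (hFu x) (hFu y) h0
        have h2 : 1 + 2 / δ ≤ 3 / δ := by
          rw [show (3 : ℝ) / δ = 1 / δ + 2 / δ by ring]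
          have : 1 ≤ 1 / δ := (one_le_div hδ).2 hδ1
          linarith
        have h3 := h1.trans (mul_le_mul_of_nonneg_right h2 (norm_nonneg _))
        have h4 := pow_le_pow_left₀ (norm_nonneg _) h3 2
        rw [mul_pow] at h4
        have h5 := mul_le_mul_of_nonneg_left h4 (abs_nonneg (σ x y))
        linarith
      rw [← e1, ← e2] at e3
      have e4 : ∑ j, signedEnergy σ (fun x => F x j) ≤ k * μ := by
        refine (Finset.sum_le_sum fun j _ => hμ j).trans ?_
        simp
      have e5 : (3 / δ) ^ 2 = 4608 * k ^ 5 := by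
        rw [div_pow, div_eq_iff (by positivity)]
        linarith
      rw [e5] at e3
      refine e3.trans ((mul_le_mul_of_nonneg_left e4 (by positivity)).trans (le_of_eq ?_))
      ring
    have hN : 1 / 2 ≤ ∑ j, ∑ x, m x * (θ i x * f j x) ^ 2 := by
      rw [Finset.sum_comm]
      have h1 : ∀ x, ∑ j, m x * (θ i x * f j x) ^ 2 = θ i x ^ 2 * (m x * ‖F x‖ ^ 2) := fun x => by
        rw [EuclideanSpace.real_norm_sq_eq, Finset.mul_sum, Finset.mul_sum]
        exact Finset.sum_congr rfl fun j _ => by simp only [hF]; ring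
      simp only [h1]
      calc _ ≤ ∑ x ∈ G i, m x * ‖F x‖ ^ 2 := hG1 i
        _ = ∑ x ∈ G i, θ i x ^ 2 * (m x * ‖F x‖ ^ 2) := by
          refine Finset.sum_congr rfl fun x hx => ?_
          have : θ i x = 1 := bump_of_mem δ ⟨x, hx, Or.inl rfl⟩
          rw [this, one_pow, one_mul]
        _ ≤ _ := Finset.sum_le_sum_of_subset_of_nonneg (Finset.subset_univ _) fun x _ _ =>
          mul_nonneg (sq_nonneg _) (mul_nonneg (hm x) (sq_nonneg _))
    by_contra! hcon
    have hN0 : ∀ j, 0 ≤ ∑ x, m x * (θ i x * f j x) ^ 2 := fun j =>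
      Finset.sum_nonneg fun x _ => mul_nonneg (hm x) (sq_nonneg _)
    have h1 : ∑ j, 9216 * k ^ 6 * μ * ∑ x, m x * (θ i x * f j x) ^ 2 <
        ∑ j, signedEnergy σ (fun x => θ i x * f j x) := by
      refine Finset.sum_lt_sum (fun j _ => ?_) ?_
      · rcases (hN0 j).eq_or_lt with h | h
        · rw [← h, mul_zero]
          exact signedEnergy_nonneg _ _
        · exact (hcon j h).le
      · obtain ⟨j, hj⟩ : ∃ j, 0 < ∑ x, m x * (θ i x * f j x) ^ 2 := by
          by_contra! h
          have := Finset.sum_nonpos fun j (_ : j ∈ Finset.univ) => h j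
          linarith
        exact ⟨j, Finset.mem_univ _, hcon j hj⟩
    rw [← Finset.mul_sum] at h1
    have h2 := mul_le_mul_of_nonneg_left hN (show 0 ≤ 9216 * (k : ℝ) ^ 6 * μ by positivity)
    linarith
  choose j hj using hpick
  refine ⟨fun i x => θ i x * f (j i) x, fun i i' hii x => ?_, fun i => (hj i).1, fun i => (hj i).2⟩
  exact (hdisj i i' hii x).imp (fun h => by simp [h]) fun h => by simp [h]

end Localization

/-! ### Weighted spectral theory and min-max. -/

section Spectral

open Matrix

variable {X : Type*} [Fintype X] [DecidableEq X]

theorem exists_orthonormal_eigenvectors {H : Matrix X X ℝ} (hH : H.IsHermitian) :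
    ∃ e : Fin (Fintype.card X) → X → ℝ, (∀ i, H *ᵥ e i = hH.eigenvalues₀ i • e i) ∧
      (∀ i j, e i ⬝ᵥ e j = if i = j then 1 else 0) ∧
      ∀ v w, v ⬝ᵥ w = ∑ j, (e j ⬝ᵥ v) * (e j ⬝ᵥ w) := by
  set φ : Fin (Fintype.card X) ≃ X := Fintype.equivOfCardEq (Fintype.card_fin _) with hφ
  have hdot : ∀ v w : EuclideanSpace ℝ X, inner ℝ v w = v.ofLp ⬝ᵥ w.ofLp := fun v w => by
    rw [EuclideanSpace.inner_eq_star_dotProduct, dotProduct_comm]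
    simp
  refine ⟨fun i => hH.eigenvectorBasis (φ i), fun i => ?_, fun i j => ?_, fun v w => ?_⟩
  · rw [hH.mulVec_eigenvectorBasis, Matrix.IsHermitian.eigenvalues]
    simp [hφ]
  · rw [← hdot, orthonormal_iff_ite.1 hH.eigenvectorBasis.orthonormal]
    simp
  · have h := hH.eigenvectorBasis.sum_inner_mul_inner (WithLp.toLp 2 v) (WithLp.toLp 2 w)
    rw [hdot] at h
    rw [← h, ← φ.sum_comp]
    refine Finset.sum_congr rfl fun j _ => ?_
    rw [hdot, hdot, dotProduct_comm]

/-- `eigenvalues₀` is decreasing, so the increasing list is its reverse and position n - k, counted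
from 0, becomes k - 1. -/
theorem getD_sort_roots_charpoly {H : Matrix X X ℝ} (hH : H.IsHermitian) {k : ℕ}
    (hk : 1 ≤ k) (hkn : k ≤ Fintype.card X) :
    (H.charpoly.roots.sort (· ≤ ·)).getD (Fintype.card X - k) 0 =
      hH.eigenvalues₀ ⟨k - 1, by lia⟩ := by
  have h1 : H.charpoly.roots.sort (· ≤ ·) = (List.ofFn hH.eigenvalues₀).reverse := by
    rw [hH.roots_charpoly_eq_eigenvalues₀, Fin.univ_val_map, ← Multiset.coe_reverse,
      Multiset.coe_sort]
    apply List.mergeSort_of_pairwise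
    simp only [decide_eq_true_eq, List.pairwise_reverse, Function.comp_def,
      RCLike.ofReal_real_eq_id, id]
    rw [List.pairwise_ofFn]
    exact fun i j hij => hH.eigenvalues₀_antitone hij.le
  rw [h1, List.getD_eq_getElem _ _ (by simp; lia), List.getElem_reverse, List.getElem_ofFn]
  congr 1
  ext
  simp
  lia

/-- The matrix `W S W`, where `W` is the diagonal matrix of the `m(x)^(-1/2)`. -/
noncomputable def normalizedMatrix (m : X → ℝ) (S : Matrix X X ℝ) : Matrix X X ℝ :=
  Matrix.of fun x y => Real.sqrt (m x)⁻¹ * S x y * Real.sqrt (m y)⁻¹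

omit [Fintype X] [DecidableEq X] in
theorem isHermitian_normalizedMatrix (m : X → ℝ) {S : Matrix X X ℝ} (hS : ∀ x y, S x y = S y x) :
    (normalizedMatrix m S).IsHermitian := by
  ext x y
  simp only [normalizedMatrix, conjTranspose_apply, of_apply, star_trivial, hS y x]
  ring

/-- With W the diagonal matrix of the √(m x)⁻¹, W (W S) and (W S) W have the same characteristic
polynomial. Points of weight 0 cause no trouble, because 0⁻¹ = 0 on both sides. -/
theorem charpoly_diagonal_inv_mul {m : X → ℝ} (hm : ∀ x, 0 ≤ m x) (S : Matrix X X ℝ) :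
    (Matrix.diagonal (fun x => (m x)⁻¹) * S).charpoly = (normalizedMatrix m S).charpoly := by
  set W : Matrix X X ℝ := Matrix.diagonal fun x => Real.sqrt (m x)⁻¹
  have h1 : Matrix.diagonal (fun x => (m x)⁻¹) = W * W := by
    rw [Matrix.diagonal_mul_diagonal]
    congr 1
    ext x
    rw [Real.mul_self_sqrt (inv_nonneg.2 (hm x))]
  have h2 : normalizedMatrix m S = W * S * W := by
    ext x y
    simp [W, normalizedMatrix, Matrix.mul_diagonal, Matrix.diagonal_mul]
  rw [h1, h2, Matrix.mul_assoc, Matrix.charpoly_mul_comm]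

omit [Fintype X] [DecidableEq X] in
theorem sqrt_inv_mul_sqrt {m : X → ℝ} {x : X} (hx : 0 < m x) :
    Real.sqrt (m x)⁻¹ * Real.sqrt (m x) = 1 := by
  rw [← Real.sqrt_mul (inv_nonneg.2 hx.le), inv_mul_cancel₀ hx.ne', Real.sqrt_one]

omit [DecidableEq X] in
theorem dotProduct_normalizedMatrix (m : X → ℝ) (S : Matrix X X ℝ) (e : X → ℝ) :
    e ⬝ᵥ normalizedMatrix m S *ᵥ e =
      (fun x => Real.sqrt (m x)⁻¹ * e x) ⬝ᵥ S *ᵥ fun x => Real.sqrt (m x)⁻¹ * e x := by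
  simp only [dotProduct, mulVec, normalizedMatrix, of_apply, Finset.mul_sum]
  refine Finset.sum_congr rfl fun x _ => Finset.sum_congr rfl fun y _ => ?_
  ring

/-- There are `k` functions, orthonormal for the weight `m`, on which the quadratic form of `S` is
at least the `k`-th largest eigenvalue. -/
theorem exists_orthonormal_eigenvalue_le {m : X → ℝ} (hm : ∀ x, 0 ≤ m x) {S : Matrix X X ℝ}
    (hS : ∀ x y, S x y = S y x) (hpos : ∀ f, 0 ≤ f ⬝ᵥ S *ᵥ f) {k : ℕ} (hk : 1 ≤ k)
    (hkm : k ≤ {x | 0 < m x}.ncard) (hkn : k ≤ Fintype.card X) :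
    ∃ f : Fin k → X → ℝ, (∀ i j, ∑ x, m x * (f i x * f j x) = if i = j then 1 else 0) ∧
      ∀ i, (isHermitian_normalizedMatrix m hS).eigenvalues₀ ⟨k - 1, by lia⟩ ≤
        f i ⬝ᵥ S *ᵥ f i := by
  set hH := isHermitian_normalizedMatrix m hS
  set l := hH.eigenvalues₀ ⟨k - 1, by lia⟩
  -- If l ≤ 0, eigenvectors might live on points of weight 0, but any orthonormal family will do as
  -- the form is nonnegative: take normalized point masses at k points of positive weight. If l > 0,
  -- the first k eigenvectors vanish where m does, and rescaling them by m^(-1/2) preserves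
  -- orthonormality.
  rcases le_or_gt l 0 with hl0 | hl0
  · have hcard : Fintype.card (Fin k) ≤ Fintype.card {x // 0 < m x} := by
      rwa [Fintype.card_fin, ← Nat.card_eq_fintype_card, ← Set.coe_ofPred, Nat.card_coe_set_eq]
    obtain ⟨p⟩ := Function.Embedding.nonempty_of_card_le hcard
    refine ⟨fun i x => if x = p i then Real.sqrt (m x)⁻¹ else 0, fun i j => ?_,
      fun i => hl0.trans (hpos _)⟩
    rw [Finset.sum_eq_single (p i : X) (fun x _ hx => by simp [hx]) (by simp)]
    by_cases hij : i = j
    · subst hij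
      have := (p i).2
      simp only [if_true]
      rw [Real.mul_self_sqrt (inv_nonneg.2 this.le),
        mul_inv_cancel₀ this.ne']
    · have : (p i : X) ≠ p j := fun h => hij (p.injective (Subtype.ext h))
      simp [this, hij]
  · obtain ⟨e, he1, he2, -⟩ := exists_orthonormal_eigenvectors hH
    set c : Fin k → Fin (Fintype.card X) := Fin.castLE hkn with hc
    have hle : ∀ i, l ≤ hH.eigenvalues₀ (c i) := fun i => hH.eigenvalues₀_antitone (by
      rw [Fin.le_def]
      simp only [hc, Fin.val_castLE]
      lia)
    have hsupp : ∀ i x, m x = 0 → e (c i) x = 0 := fun i x hx => by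
      have h1 := congrFun (he1 (c i)) x
      have h2 : (normalizedMatrix m S *ᵥ e (c i)) x = 0 := by
        simp [mulVec, dotProduct, normalizedMatrix, hx]
      rw [h2, Pi.smul_apply, smul_eq_mul] at h1
      rcases mul_eq_zero.1 h1.symm with h | h
      · have := hle i
        linarith
      · exact h
    refine ⟨fun i x => Real.sqrt (m x)⁻¹ * e (c i) x, fun i j => ?_, fun i => ?_⟩
    · have hij : (if c i = c j then (1 : ℝ) else 0) = if i = j then 1 else 0 := by simp [hc]
      rw [← hij, ← he2]
      refine Finset.sum_congr rfl fun x _ => ?_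
      rcases (hm x).eq_or_lt with h | h
      · simp [hsupp i x h.symm]
      · rw [show m x * (Real.sqrt (m x)⁻¹ * e (c i) x * (Real.sqrt (m x)⁻¹ * e (c j) x)) =
          (Real.sqrt (m x)⁻¹ * Real.sqrt (m x)⁻¹) * m x * (e (c i) x * e (c j) x) by ring,
          Real.mul_self_sqrt (inv_nonneg.2 h.le), inv_mul_cancel₀ h.ne', one_mul]
    · rw [← dotProduct_normalizedMatrix, he1, dotProduct_smul, he2, if_pos rfl, smul_eq_mul,
        mul_one]
      exact hle i

/-- One direction of the min-max principle. -/
theorem le_eigenvalue_of_le_on_span {m : X → ℝ} (hm : ∀ x, 0 ≤ m x) {S : Matrix X X ℝ}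
    (hS : ∀ x y, S x y = S y x) (hSm : ∀ x y, m x = 0 → S x y = 0) {k : ℕ} (hk : 1 ≤ k)
    (hkn : k ≤ Fintype.card X) {g : Fin k → X → ℝ} {l : ℝ}
    (hg : ∀ c : Fin k → ℝ, c ≠ 0 → 0 < ∑ x, m x * (∑ i, c i * g i x) ^ 2)
    (hl : ∀ c : Fin k → ℝ, l * ∑ x, m x * (∑ i, c i * g i x) ^ 2 ≤
      (fun x => ∑ i, c i * g i x) ⬝ᵥ S *ᵥ fun x => ∑ i, c i * g i x) :
    l ≤ (isHermitian_normalizedMatrix m hS).eigenvalues₀ ⟨k - 1, by lia⟩ := by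
  set hH := isHermitian_normalizedMatrix m hS
  obtain ⟨e, he1, he2, he3⟩ := exists_orthonormal_eigenvectors hH
  let b : Fin (k - 1) → Fin (Fintype.card X) := Fin.castLE (by lia)
  let Φ : (Fin k → ℝ) →ₗ[ℝ] (Fin (k - 1) → ℝ) :=
    { toFun := fun c j => e (b j) ⬝ᵥ fun x => Real.sqrt (m x) * ∑ i, c i * g i x
      map_add' := fun c c' => by
        ext j
        simp only [dotProduct, Pi.add_apply, Finset.sum_add_distrib, add_mul, mul_add]
      map_smul' := fun a c => by
        ext j
        simp only [dotProduct, Pi.smul_apply, smul_eq_mul, Finset.mul_sum, RingHom.id_apply]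
        refine Finset.sum_congr rfl fun x _ => Finset.sum_congr rfl fun i _ => ?_
        ring }
  -- A k-dimensional space of coefficients meets k - 1 conditions, so some nonzero combination is
  -- orthogonal to the first k - 1 eigenvectors.
  have hker : LinearMap.ker Φ ≠ ⊥ := LinearMap.ker_ne_bot_of_finrank_lt (by simp; lia)
  obtain ⟨c, hc, hc0⟩ := Submodule.exists_mem_ne_zero_of_ne_bot hker
  set G : X → ℝ := fun x => ∑ i, c i * g i x with hG
  set v : X → ℝ := fun x => Real.sqrt (m x) * G x with hv
  have hzero : ∀ j : Fin (Fintype.card X), (j : ℕ) < k - 1 → e j ⬝ᵥ v = 0 := fun j hj =>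
    congrFun (LinearMap.mem_ker.1 hc) ⟨j, hj⟩
  have hvv : v ⬝ᵥ v = ∑ x, m x * G x ^ 2 := by
    refine Finset.sum_congr rfl fun x _ => ?_
    rw [hv]
    dsimp only
    rw [show Real.sqrt (m x) * G x * (Real.sqrt (m x) * G x) =
      (Real.sqrt (m x) * Real.sqrt (m x)) * G x ^ 2 by ring, Real.mul_self_sqrt (hm x)]
  have hvH : v ⬝ᵥ normalizedMatrix m S *ᵥ v = G ⬝ᵥ S *ᵥ G := by
    rw [dotProduct_normalizedMatrix]
    simp only [dotProduct, mulVec, Finset.mul_sum]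
    refine Finset.sum_congr rfl fun x _ => Finset.sum_congr rfl fun y _ => ?_
    rcases (hm x).eq_or_lt with h | h
    · simp [hSm x y h.symm]
    rcases (hm y).eq_or_lt with h' | h'
    · simp [hS x y, hSm y x h'.symm]
    simp only [hv, ← mul_assoc (Real.sqrt (m _)⁻¹) (Real.sqrt (m _))]
    rw [sqrt_inv_mul_sqrt h, sqrt_inv_mul_sqrt h', one_mul, one_mul]
  have hQ : v ⬝ᵥ normalizedMatrix m S *ᵥ v = ∑ j, hH.eigenvalues₀ j * (e j ⬝ᵥ v) ^ 2 := by
    rw [he3]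
    refine Finset.sum_congr rfl fun j _ => ?_
    have h1 : e j ⬝ᵥ normalizedMatrix m S *ᵥ v = hH.eigenvalues₀ j * (e j ⬝ᵥ v) := by
      have ht : (normalizedMatrix m S)ᵀ = normalizedMatrix m S := by
        have := hH.eq
        rwa [conjTranspose_eq_transpose_of_trivial] at this
      rw [dotProduct_mulVec, ← mulVec_transpose, ht, he1, smul_dotProduct, smul_eq_mul]
    rw [h1]
    ring
  have hle : v ⬝ᵥ normalizedMatrix m S *ᵥ v ≤ hH.eigenvalues₀ ⟨k - 1, by lia⟩ * (v ⬝ᵥ v) := by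
    rw [hQ, he3 v v, Finset.mul_sum]
    refine Finset.sum_le_sum fun j _ => ?_
    by_cases hj : (j : ℕ) < k - 1
    · simp [hzero j hj]
    · rw [← sq]
      refine mul_le_mul_of_nonneg_right (hH.eigenvalues₀_antitone ?_) (sq_nonneg _)
      rw [Fin.le_def]
      push Not at hj
      exact hj
  rw [hvH, hvv] at hle
  exact le_of_mul_le_mul_right ((hl c).trans hle) (hg c hc0)

end Spectral

/-! ### Incidence signs, degrees and the energy identity. -/

section Facets

variable {V : Type*} {K : PreAbstractSimplicialComplex V}

/-- Exactly one vertex of ρ is missing from τ; its position is the only possible j, and matching the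
remaining vertices determines π. -/
theorem sgn_eq_one_or_neg_one (o : SimplexOrientation K) {d : ℕ} {τ : Simplex K d}
    {ρ : Simplex K (d + 1)} (h : τ.1 ⊆ ρ.1) : sgn o τ ρ = 1 ∨ sgn o τ ρ = -1 := by
  classical
  have hcard : (ρ.1 \ τ.1).card = 1 := by
    rw [Finset.card_sdiff_of_subset h, τ.2.2, ρ.2.2]
    lia
  obtain ⟨v, hv⟩ := Finset.card_eq_one.1 hcard
  have hvmem : v ∈ ρ.1 ∧ v ∉ τ.1 := Finset.mem_sdiff.1 (hv ▸ Finset.mem_singleton_self v)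
  have hmem : ∀ w ∈ ρ.1, w ≠ v → w ∈ τ.1 := fun w hw hne => by
    by_contra hwτ
    have : w ∈ ρ.1 \ τ.1 := Finset.mem_sdiff.2 ⟨hw, hwτ⟩
    rw [hv] at this
    exact hne (Finset.mem_singleton.1 this)
  set j₀ := (o (d + 1) ρ).symm ⟨v, hvmem.1⟩ with hj₀
  have hj₀v : o (d + 1) ρ j₀ = ⟨v, hvmem.1⟩ := by simp [hj₀]
  have hval : ∀ i, ((o (d + 1) ρ (j₀.succAbove i) : {v : V // v ∈ ρ.1}) : V) ∈ τ.1 := fun i => by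
    refine hmem _ (Subtype.property _) fun heq => ?_
    have h1 : o (d + 1) ρ (j₀.succAbove i) = o (d + 1) ρ j₀ := by
      rw [hj₀v]
      exact Subtype.ext heq
    exact Fin.succAbove_ne j₀ i ((o (d + 1) ρ).injective h1)
  set φ : Fin (d + 1) → Fin (d + 1) := fun i => (o d τ).symm ⟨_, hval i⟩ with hφ
  have hφinj : Function.Injective φ := fun i i' hii => by
    have h1 := (o d τ).symm.injective hii
    have h2 := congrArg Subtype.val h1
    exact Fin.succAbove_right_injective ((o (d + 1) ρ).injective (Subtype.ext h2))
  set π₀ : Equiv.Perm (Fin (d + 1)) := Equiv.ofBijective φ (Finite.injective_iff_bijective.1 hφinj)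
    with hπ₀
  have hother : ∀ j ≠ j₀, ∀ π : Equiv.Perm (Fin (d + 1)),
      ¬ ∀ i, ((o (d + 1) ρ (j.succAbove i) : {v : V // v ∈ ρ.1}) : V) = (o d τ (π i) : V) := by
    intro j hj π hall
    obtain ⟨i, hi⟩ := Fin.exists_succAbove_eq hj.symm
    have h1 := hall i
    rw [hi, hj₀v] at h1
    change v = (o d τ (π i) : V) at h1
    rw [h1] at hvmem
    exact hvmem.2 (o d τ (π i)).2
  have hπ : ∀ π : Equiv.Perm (Fin (d + 1)),
      (∀ i, ((o (d + 1) ρ (j₀.succAbove i) : {v : V // v ∈ ρ.1}) : V) = (o d τ (π i) : V)) ↔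
        π = π₀ := fun π => by
    rw [Equiv.ext_iff]
    refine forall_congr' fun i => ?_
    rw [hπ₀, Equiv.ofBijective_apply, hφ, Equiv.eq_symm_apply]
    constructor
    · exact fun h => Subtype.ext h.symm
    · exact fun h => (congrArg Subtype.val h).symm
  have hsgn : sgn o τ ρ = (-1) ^ (j₀ : ℕ) * ((Equiv.Perm.sign π₀ : ℤˣ) : ℤ) := by
    unfold sgn
    rw [Finset.sum_eq_single j₀ (fun j _ hj => Finset.sum_eq_zero fun π _ => if_neg (hother j hj π))
      (by simp),
      Finset.sum_eq_single π₀ (fun π _ hne => if_neg fun h => hne ((hπ π).1 h)) (by simp),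
      if_pos ((hπ π₀).2 rfl)]
  rw [hsgn]
  rcases neg_one_pow_eq_or ℤ (j₀ : ℕ) with h1 | h1 <;>
    rcases Int.units_eq_one_or (Equiv.Perm.sign π₀) with h2 | h2 <;> simp [h1, h2]

open Classical in
theorem sgn_sq (o : SimplexOrientation K) {d : ℕ} (τ : Simplex K d) (ρ : Simplex K (d + 1)) :
    sgn o τ ρ ^ 2 = if τ.1 ⊆ ρ.1 then 1 else 0 := by
  split_ifs with h
  · rcases sgn_eq_one_or_neg_one o h with h1 | h1 <;> simp [h1]
  · by_contra hne
    exact h (subset_of_sgn_ne_zero o τ ρ fun h0 => hne (by simp [h0]))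

/-- The union of τ and τ' already has d + 2 vertices, so it is the whole coface. -/
theorem eq_of_subset_of_subset {d : ℕ} {τ τ' : Simplex K d} (hne : τ ≠ τ')
    {ρ ρ' : Simplex K (d + 1)} (h : τ.1 ⊆ ρ.1) (h' : τ'.1 ⊆ ρ.1) (g : τ.1 ⊆ ρ'.1)
    (g' : τ'.1 ⊆ ρ'.1) : ρ = ρ' := by
  classical
  have hlt : d + 2 ≤ (τ.1 ∪ τ'.1).card := by
    have hss : τ.1 ⊂ τ.1 ∪ τ'.1 := by
      refine Finset.ssubset_iff_subset_ne.2 ⟨Finset.subset_union_left, fun heq => ?_⟩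
      have h1 : τ'.1 ⊆ τ.1 := heq ▸ Finset.subset_union_right
      exact hne (Subtype.ext (Finset.eq_of_subset_of_card_le h1 (by rw [τ.2.2, τ'.2.2])).symm)
    have := Finset.card_lt_card hss
    rw [τ.2.2] at this
    lia
  have e1 : τ.1 ∪ τ'.1 = ρ.1 :=
    Finset.eq_of_subset_of_card_le (Finset.union_subset h h') (by rw [ρ.2.2]; exact hlt)
  have e2 : τ.1 ∪ τ'.1 = ρ'.1 :=
    Finset.eq_of_subset_of_card_le (Finset.union_subset g g') (by rw [ρ'.2.2]; exact hlt)
  exact Subtype.ext (e1.symm.trans e2)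

variable [Finite V]

theorem sum_sgn_sq_facets (o : SimplexOrientation K) {d : ℕ} (ρ : Simplex K (d + 1)) :
    ∑ τ : Simplex K d, sgn o τ ρ ^ 2 = d + 2 := by
  classical
  simp only [sgn_sq, Finset.sum_boole]
  have h : ((Finset.univ : Finset (Simplex K d)).filter fun τ => τ.1 ⊆ ρ.1).card =
      (ρ.1.powersetCard (d + 1)).card := by
    refine Finset.card_bij (fun τ _ => τ.1) (fun τ hτ => ?_) (fun τ _ τ' _ h => Subtype.ext h)
      fun s hs => ?_
    · rw [Finset.mem_powersetCard]
      exact ⟨(Finset.mem_filter.1 hτ).2, τ.2.2⟩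
    · rw [Finset.mem_powersetCard] at hs
      have hs0 : s.Nonempty := Finset.card_pos.1 (by lia)
      exact ⟨⟨s, (K.isRelLowerSet_faces ρ.2.1).2 hs.1 hs0, hs.2⟩,
        Finset.mem_filter.2 ⟨Finset.mem_univ _, hs.1⟩, rfl⟩
  rw [h, Finset.card_powersetCard, ρ.2.2, Nat.choose_succ_self_right]
  push_cast
  ring

theorem sum_sgn_sq_cofaces (o : SimplexOrientation K) {d : ℕ} (τ : Simplex K d) :
    ∑ ρ : Simplex K (d + 1), sgn o τ ρ ^ 2 = deg τ := by
  classical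
  simp only [sgn_sq, Finset.sum_boole]
  rw [deg, Set.ncard_eq_toFinset_card']
  simp

theorem edgeSign_self (o : SimplexOrientation K) {d : ℕ} (τ : Simplex K d) :
    edgeSign o τ τ = deg τ := by
  rw [← sum_sgn_sq_cofaces o τ, edgeSign]
  exact Finset.sum_congr rfl fun ρ _ => (sq _).symm

theorem edgeSign_comm (o : SimplexOrientation K) {d : ℕ} (τ τ' : Simplex K d) :
    edgeSign o τ τ' = edgeSign o τ' τ :=
  Finset.sum_congr rfl fun _ _ => mul_comm _ _

theorem edgeSign_of_subset (o : SimplexOrientation K) {d : ℕ} {τ τ' : Simplex K d} (hne : τ ≠ τ')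
    {ρ : Simplex K (d + 1)} (h : τ.1 ⊆ ρ.1) (h' : τ'.1 ⊆ ρ.1) :
    edgeSign o τ τ' = sgn o τ ρ * sgn o τ' ρ := by
  refine Finset.sum_eq_single ρ (fun ρ' _ hρ => ?_) (by simp)
  by_contra h0
  exact hρ (eq_of_subset_of_subset hne (subset_of_sgn_ne_zero o _ _ (left_ne_zero_of_mul h0))
    (subset_of_sgn_ne_zero o _ _ (right_ne_zero_of_mul h0)) h h')

theorem edgeSign_of_not_adj (o : SimplexOrientation K) {d : ℕ} {τ τ' : Simplex K d} (hne : τ ≠ τ')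
    (h : ¬ (upGraph K d).Adj τ τ') : edgeSign o τ τ' = 0 := by
  refine Finset.sum_eq_zero fun ρ _ => ?_
  by_contra h0
  exact h ⟨hne, ρ, subset_of_sgn_ne_zero o _ _ (left_ne_zero_of_mul h0),
    subset_of_sgn_ne_zero o _ _ (right_ne_zero_of_mul h0)⟩

theorem edgeSign_of_adj (o : SimplexOrientation K) {d : ℕ} {τ τ' : Simplex K d}
    (h : (upGraph K d).Adj τ τ') : edgeSign o τ τ' = 1 ∨ edgeSign o τ τ' = -1 := by
  obtain ⟨hne, ρ, h1, h2⟩ := h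
  rw [edgeSign_of_subset o hne h1 h2]
  rcases sgn_eq_one_or_neg_one o h1 with h3 | h3 <;>
    rcases sgn_eq_one_or_neg_one o h2 with h4 | h4 <;> simp [h3, h4]

/-- At most one coface contributes, so no cancellation occurs. The right-hand side lets the sums
over τ' and ρ be exchanged when neighbours are counted. -/
theorem abs_edgeSign (o : SimplexOrientation K) {d : ℕ} {τ τ' : Simplex K d} (hne : τ ≠ τ') :
    |edgeSign o τ τ'| = ∑ ρ, sgn o τ ρ ^ 2 * sgn o τ' ρ ^ 2 := by
  have key : ∀ ρ, sgn o τ ρ ^ 2 * sgn o τ' ρ ^ 2 = |sgn o τ ρ * sgn o τ' ρ| := fun ρ => by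
    by_cases h : τ.1 ⊆ ρ.1
    · by_cases h' : τ'.1 ⊆ ρ.1
      · rcases sgn_eq_one_or_neg_one o h with h3 | h3 <;>
          rcases sgn_eq_one_or_neg_one o h' with h4 | h4 <;> simp [h3, h4]
      · have : sgn o τ' ρ = 0 := by
          by_contra h0
          exact h' (subset_of_sgn_ne_zero o _ _ h0)
        simp [this]
    · have : sgn o τ ρ = 0 := by
        by_contra h0
        exact h (subset_of_sgn_ne_zero o _ _ h0)
      simp [this]
  simp only [key]
  by_cases hadj : (upGraph K d).Adj τ τ'
  · obtain ⟨-, ρ, h1, h2⟩ := hadj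
    rw [edgeSign_of_subset o hne h1 h2]
    symm
    refine Finset.sum_eq_single ρ (fun ρ' _ hρ => ?_) (by simp)
    by_contra h0
    rw [abs_eq_zero] at h0
    exact hρ (eq_of_subset_of_subset hne (subset_of_sgn_ne_zero o _ _ (left_ne_zero_of_mul h0))
      (subset_of_sgn_ne_zero o _ _ (right_ne_zero_of_mul h0)) h1 h2)
  · rw [edgeSign_of_not_adj o hne hadj, abs_zero]
    refine (Finset.sum_eq_zero fun ρ _ => ?_).symm
    by_contra h0
    rw [abs_eq_zero] at h0
    exact hadj ⟨hne, ρ, subset_of_sgn_ne_zero o _ _ (left_ne_zero_of_mul h0),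
      subset_of_sgn_ne_zero o _ _ (right_ne_zero_of_mul h0)⟩

/-- The signed adjacency matrix of `Γ_d`. -/
noncomputable def signedAdj (o : SimplexOrientation K) {d : ℕ} (τ τ' : Simplex K d) : ℝ :=
  if τ = τ' then 0 else edgeSign o τ τ'

theorem signedAdj_of_not_adj (o : SimplexOrientation K) {d : ℕ} {τ τ' : Simplex K d}
    (h : ¬ (upGraph K d).Adj τ τ') : signedAdj o τ τ' = 0 := by
  unfold signedAdj
  split_ifs with hne
  · rfl
  · rw [edgeSign_of_not_adj o hne h, Int.cast_zero]

theorem signedAdj_of_adj (o : SimplexOrientation K) {d : ℕ} {τ τ' : Simplex K d}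
    (h : (upGraph K d).Adj τ τ') : signedAdj o τ τ' = edgeSign o τ τ' := if_neg h.1

theorem signedAdj_cases (o : SimplexOrientation K) {d : ℕ} (τ τ' : Simplex K d) :
    signedAdj o τ τ' = 0 ∨ signedAdj o τ τ' = 1 ∨ signedAdj o τ τ' = -1 := by
  by_cases h : (upGraph K d).Adj τ τ'
  · right
    rw [signedAdj_of_adj o h]
    exact_mod_cast edgeSign_of_adj o h
  · exact Or.inl (signedAdj_of_not_adj o h)

theorem signedAdj_comm (o : SimplexOrientation K) {d : ℕ} (τ τ' : Simplex K d) :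
    signedAdj o τ τ' = signedAdj o τ' τ := by
  unfold signedAdj
  rw [edgeSign_comm o τ τ']
  by_cases h : τ = τ'
  · rw [if_pos h, if_pos h.symm]
  · rw [if_neg h, if_neg (Ne.symm h)]

/-- Each coface of τ has d + 2 facets, one of which is τ itself. -/
theorem sum_abs_signedAdj (o : SimplexOrientation K) {d : ℕ} (τ : Simplex K d) :
    ∑ τ', |signedAdj o τ τ'| = ((d : ℝ) + 1) * deg τ := by
  have h1 : ∀ τ', |signedAdj o τ τ'| =
      (((∑ ρ, sgn o τ ρ ^ 2 * sgn o τ' ρ ^ 2) - if τ = τ' then (deg τ : ℤ) else 0 : ℤ) : ℝ) := by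
    intro τ'
    unfold signedAdj
    split_ifs with h
    · subst h
      rw [abs_zero, ← sum_sgn_sq_cofaces o τ, eq_comm, Int.cast_eq_zero, sub_eq_zero]
      refine Finset.sum_congr rfl fun ρ _ => ?_
      rw [← sq, sgn_sq]
      split_ifs <;> simp
    · rw [sub_zero, ← abs_edgeSign o h, Int.cast_abs]
  simp only [h1]
  rw [← Int.cast_sum, Finset.sum_sub_distrib, Finset.sum_comm]
  simp only [← Finset.mul_sum, sum_sgn_sq_facets]
  rw [← Finset.sum_mul, sum_sgn_sq_cofaces]
  simp
  ring

/-- The matrix `δ^T δ`. -/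
noncomputable def gramMatrix (o : SimplexOrientation K) (d : ℕ) :
    Matrix (Simplex K d) (Simplex K d) ℝ :=
  Matrix.of fun τ τ' => (edgeSign o τ τ' : ℝ)

theorem gramMatrix_eq (o : SimplexOrientation K) (d : ℕ) :
    gramMatrix o d = (coboundary o d).transpose * coboundary o d := by
  ext τ τ'
  simp [gramMatrix, edgeSign, coboundary, Matrix.mul_apply]

theorem gramMatrix_comm (o : SimplexOrientation K) (d : ℕ) (τ τ' : Simplex K d) :
    gramMatrix o d τ τ' = gramMatrix o d τ' τ := by
  simp [gramMatrix, edgeSign_comm]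

theorem gramMatrix_of_deg_eq_zero (o : SimplexOrientation K) (d : ℕ) (τ τ' : Simplex K d)
    (h : (deg τ : ℝ) = 0) : gramMatrix o d τ τ' = 0 := by
  have h0 : deg τ = 0 := by exact_mod_cast h
  simp only [gramMatrix, edgeSign, Matrix.of_apply, Int.cast_eq_zero]
  refine Finset.sum_eq_zero fun ρ _ => ?_
  by_contra hne
  exact (deg_pos_of_sgn_ne_zero o τ ρ (left_ne_zero_of_mul hne)).ne' h0

theorem upLaplacian_eq (o : SimplexOrientation K) (d : ℕ) :
    upLaplacian o d = Matrix.diagonal (fun τ => (deg τ : ℝ)⁻¹) * gramMatrix o d := by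
  rw [gramMatrix_eq, ← Matrix.mul_assoc, upLaplacian]
  congr 1
  ext τ ρ
  simp [coboundaryAdjoint, coboundary, Matrix.diagonal_mul]

open Matrix in
theorem gramMatrix_nonneg (o : SimplexOrientation K) (d : ℕ) (f : Simplex K d → ℝ) :
    0 ≤ f ⬝ᵥ gramMatrix o d *ᵥ f := by
  rw [gramMatrix_eq, ← mulVec_mulVec, dotProduct_mulVec, vecMul_transpose]
  exact Finset.sum_nonneg fun _ _ => mul_self_nonneg _

open Matrix in
/-- The form of `d + 2 - Δ` is the energy of the signed graph `Γ_d`. -/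
theorem signedEnergy_signedAdj (o : SimplexOrientation K) {d : ℕ} (f : Simplex K d → ℝ) :
    signedEnergy (signedAdj o) f =
      ((d : ℝ) + 2) * ∑ τ, deg τ * f τ ^ 2 - f ⬝ᵥ gramMatrix o d *ᵥ f := by
  -- The cross term is that of δᵀδ with its diagonal deg removed; putting the diagonal back turns d
  -- + 1 into d + 2.
  have h1 : ∀ τ τ' : Simplex K d, |signedAdj o τ τ'| * (f τ - signedAdj o τ τ' * f τ') ^ 2 =
      |signedAdj o τ τ'| * (f τ ^ 2 + f τ' ^ 2) - 2 * (f τ * (gramMatrix o d τ τ' * f τ') -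
        if τ = τ' then deg τ * f τ ^ 2 else 0) := fun τ τ' => by
    by_cases h : τ = τ'
    · subst h
      simp [signedAdj, gramMatrix, edgeSign_self]
      ring
    · have h2 : gramMatrix o d τ τ' = signedAdj o τ τ' := by simp [signedAdj, h, gramMatrix]
      rw [h2, if_neg h]
      rcases signedAdj_cases o τ τ' with h0 | h0 | h0 <;> rw [h0]
      · simp
      · simp
        ring
      · simp
        ring
  unfold signedEnergy
  simp only [h1, Finset.sum_sub_distrib, ← Finset.mul_sum]
  rw [sum_abs_mul_sq_add_sq (signedAdj_comm o) (sum_abs_signedAdj o)]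
  simp only [dotProduct, mulVec, Finset.mul_sum, Finset.sum_ite_eq, Finset.mem_univ, if_true]
  rw [← Finset.mul_sum, ← Finset.mul_sum]
  ring

end Facets

/-! ### Edge counts as double sums. -/

section Counting

variable {X : Type*} [Fintype X]

/-- The handshake lemma for the graph of r. It lets edge counts be compared term by term with sums
over ordered pairs. -/
theorem two_mul_ncard_edges {r : X → X → Prop} [DecidableRel r]
    (hr : ∀ x y, r x y → r y x) (hr' : ∀ x, ¬ r x x) :
    2 * {e : Sym2 X | ∃ x y, r x y ∧ e = s(x, y)}.ncard =
      ∑ x, ∑ y, if r x y then 1 else 0 := by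
  classical
  let G : SimpleGraph X := { Adj := r, symm := ⟨hr⟩, loopless := ⟨hr'⟩ }
  have h1 : {e : Sym2 X | ∃ x y, r x y ∧ e = s(x, y)} = G.edgeSet := by
    ext e
    induction e with
    | _ a b =>
      simp only [Set.mem_ofPred_eq, SimpleGraph.mem_edgeSet]
      constructor
      · rintro ⟨x, y, hxy, h⟩
        rcases Sym2.eq_iff.1 h with ⟨rfl, rfl⟩ | ⟨rfl, rfl⟩
        · exact hxy
        · exact hr _ _ hxy
      · exact fun h => ⟨a, b, h, rfl⟩
  rw [h1, Set.ncard_eq_toFinset_card', ← SimpleGraph.edgeFinset,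
    ← G.sum_degrees_eq_twice_card_edges]
  refine Finset.sum_congr rfl fun x _ => ?_
  rw [Finset.sum_boole, ← G.card_neighborFinset_eq_degree, G.neighborFinset_eq_filter]
  rfl

end Counting

/-! ### The ratio β as a total variation. -/

section Pairs

variable {V : Type*} [Finite V] {K : PreAbstractSimplicialComplex V} {d : ℕ}

/-- The function `1_A - 1_{A'}`. -/
noncomputable def pairSign (A A' : Finset (Simplex K d)) (τ : Simplex K d) : ℝ :=
  if τ ∈ A then 1 else if τ ∈ A' then -1 else 0

theorem two_mul_signedEdges (o : SimplexOrientation K) (c : ℤ) (A B : Finset (Simplex K d)) :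
    2 * (signedEdges o c A B : ℝ) = ∑ τ, ∑ τ', open Classical in
      if ((τ ∈ A ∧ τ' ∈ B ∨ τ ∈ B ∧ τ' ∈ A) ∧ (upGraph K d).Adj τ τ' ∧ edgeSign o τ τ' = c)
        then 1 else 0 := by
  classical
  have h := two_mul_ncard_edges (r := fun τ τ' : Simplex K d =>
    (τ ∈ A ∧ τ' ∈ B ∨ τ ∈ B ∧ τ' ∈ A) ∧ (upGraph K d).Adj τ τ' ∧ edgeSign o τ τ' = c)
    (fun τ τ' h => ⟨by tauto, h.2.1.symm, edgeSign_comm o τ τ' ▸ h.2.2⟩)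
    (fun τ h => (upGraph K d).irrefl h.2.1)
  have hset : {e : Sym2 (Simplex K d) | ∃ τ ∈ A, ∃ τ' ∈ B,
      e = s(τ, τ') ∧ (upGraph K d).Adj τ τ' ∧ edgeSign o τ τ' = c} =
      {e | ∃ τ τ', ((τ ∈ A ∧ τ' ∈ B ∨ τ ∈ B ∧ τ' ∈ A) ∧ (upGraph K d).Adj τ τ' ∧
        edgeSign o τ τ' = c) ∧ e = s(τ, τ')} := by
    ext e
    constructor
    · rintro ⟨τ, hτ, τ', hτ', he, h1, h2⟩
      exact ⟨τ, τ', ⟨Or.inl ⟨hτ, hτ'⟩, h1, h2⟩, he⟩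
    · rintro ⟨τ, τ', ⟨⟨hτ, hτ'⟩ | ⟨hτ, hτ'⟩, h1, h2⟩, he⟩
      · exact ⟨τ, hτ, τ', hτ', he, h1, h2⟩
      · exact ⟨τ', hτ', τ, hτ, he.trans Sym2.eq_swap, h1.symm, edgeSign_comm o τ τ' ▸ h2⟩
  rw [signedEdges, hset]
  exact_mod_cast h

theorem two_mul_boundarySize (A : Finset (Simplex K d)) :
    2 * (boundarySize A : ℝ) = ∑ τ, ∑ τ', open Classical in
      if ((τ ∈ A ∧ τ' ∉ A ∨ τ ∉ A ∧ τ' ∈ A) ∧ (upGraph K d).Adj τ τ') then 1 else 0 := by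
  classical
  have h := two_mul_ncard_edges (r := fun τ τ' : Simplex K d =>
    (τ ∈ A ∧ τ' ∉ A ∨ τ ∉ A ∧ τ' ∈ A) ∧ (upGraph K d).Adj τ τ')
    (fun τ τ' h => ⟨by tauto, h.2.symm⟩) (fun τ h => (upGraph K d).irrefl h.2)
  have hset : {e : Sym2 (Simplex K d) | ∃ τ ∈ A, ∃ τ' ∉ A,
      e = s(τ, τ') ∧ (upGraph K d).Adj τ τ'} =
      {e | ∃ τ τ', ((τ ∈ A ∧ τ' ∉ A ∨ τ ∉ A ∧ τ' ∈ A) ∧ (upGraph K d).Adj τ τ') ∧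
        e = s(τ, τ')} := by
    ext e
    constructor
    · rintro ⟨τ, hτ, τ', hτ', he, h1⟩
      exact ⟨τ, τ', ⟨Or.inl ⟨hτ, hτ'⟩, h1⟩, he⟩
    · rintro ⟨τ, τ', ⟨⟨hτ, hτ'⟩ | ⟨hτ, hτ'⟩, h1⟩, he⟩
      · exact ⟨τ, hτ, τ', hτ', he, h1⟩
      · exact ⟨τ', hτ', τ, hτ, he.trans Sym2.eq_swap, h1.symm⟩
  rw [boundarySize, hset]
  exact_mod_cast h

omit [Finite V] in
theorem abs_pairSign (A A' : Finset (Simplex K d)) (τ : Simplex K d) :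
    |pairSign A A' τ| = if τ ∈ A ∪ A' then 1 else 0 := by
  unfold pairSign
  by_cases h : τ ∈ A <;> by_cases h' : τ ∈ A' <;> simp [h, h']

theorem sum_deg_mul_abs_pairSign (A A' : Finset (Simplex K d)) :
    ∑ τ, (deg τ : ℝ) * |pairSign A A' τ| = vol (A ∪ A') := by
  simp only [abs_pairSign, vol, mul_ite, mul_one, mul_zero, Finset.sum_ite_mem, Finset.univ_inter,
    Nat.cast_sum]

/-- An edge contributes 2 if it is negative inside A or inside A', or positive between them, 1 if it
leaves the union, and 0 otherwise. -/
theorem signedVariation_pairSign (o : SimplexOrientation K) {A A' : Finset (Simplex K d)}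
    (hA : Disjoint A A') :
    signedVariation (signedAdj o) (pairSign A A') =
      2 * ((signedEdges o (-1) A A : ℝ) + signedEdges o (-1) A' A' + signedEdges o 1 A A')
        + boundarySize (A ∪ A') := by
  classical
  have h : ∑ τ, ∑ τ', |signedAdj o τ τ'| *
        |pairSign A A' τ - signedAdj o τ τ' * pairSign A A' τ'| =
      2 * (2 * (signedEdges o (-1) A A : ℝ) + 2 * signedEdges o (-1) A' A' +
        2 * signedEdges o 1 A A') + 2 * boundarySize (A ∪ A') := by
    rw [two_mul_signedEdges, two_mul_signedEdges, two_mul_signedEdges, two_mul_boundarySize,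
      ← Finset.sum_add_distrib, ← Finset.sum_add_distrib, Finset.mul_sum, ← Finset.sum_add_distrib]
    refine Finset.sum_congr rfl fun τ _ => ?_
    rw [← Finset.sum_add_distrib, ← Finset.sum_add_distrib, Finset.mul_sum,
      ← Finset.sum_add_distrib]
    refine Finset.sum_congr rfl fun τ' _ => ?_
    by_cases hadj : (upGraph K d).Adj τ τ'
    · rw [signedAdj_of_adj o hadj]
      have hd : ∀ x, x ∈ A → x ∉ A' := fun x h => Finset.disjoint_left.1 hA h
      rcases edgeSign_of_adj o hadj with hs | hs <;>
        by_cases h1 : τ ∈ A <;> by_cases h2 : τ' ∈ A <;> by_cases h3 : τ ∈ A' <;>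
        by_cases h4 : τ' ∈ A' <;>
        first
        | exact absurd h3 (hd _ h1)
        | exact absurd h4 (hd _ h2)
        | (simp [pairSign, hs, hadj, h1, h2, h3, h4] <;> norm_num)
    · simp [signedAdj_of_not_adj o hadj, hadj]
  unfold signedVariation
  rw [h]
  ring

theorem beta_eq (o : SimplexOrientation K) {A A' : Finset (Simplex K d)} (hA : Disjoint A A') :
    beta o A A' = signedVariation (signedAdj o) (pairSign A A') / vol (A ∪ A') := by
  rw [beta, signedVariation_pairSign o hA]

theorem beta_nonneg (o : SimplexOrientation K) (A A' : Finset (Simplex K d)) :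
    0 ≤ beta o A A' := by
  unfold beta
  positivity

end Pairs

/-! ### Bounding the Cheeger constants by Rayleigh quotients. -/

section LowerBound

variable {V : Type*} [Finite V] {K : PreAbstractSimplicialComplex V} {d : ℕ}

/-- There are finitely many pairs, and a simplex where deg τ f(τ)² > 0, paired with ∅, shows that
one qualifies. The minimal ratio serves as h for all level pairs of f at once. -/
theorem exists_pair_beta_le (o : SimplexOrientation K) {f : Simplex K d → ℝ}
    (hf : 0 < ∑ τ, (deg τ : ℝ) * f τ ^ 2) :
    ∃ A A' : Finset (Simplex K d), Disjoint A A' ∧ (∀ τ ∈ A ∪ A', f τ ≠ 0) ∧ 0 < vol (A ∪ A') ∧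
      ∀ B B' : Finset (Simplex K d), Disjoint B B' → (∀ τ ∈ B ∪ B', f τ ≠ 0) →
        0 < vol (B ∪ B') → beta o A A' ≤ beta o B B' := by
  have hP : {A : Finset (Simplex K d) × Finset (Simplex K d) |
      Disjoint A.1 A.2 ∧ (∀ τ ∈ A.1 ∪ A.2, f τ ≠ 0) ∧ 0 < vol (A.1 ∪ A.2)}.Nonempty := by
    obtain ⟨τ, -, hτ⟩ := Finset.exists_lt_of_sum_lt (f := fun _ => (0 : ℝ)) (s := Finset.univ)
      (g := fun τ : Simplex K d => (deg τ : ℝ) * f τ ^ 2) (by simpa using hf)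
    refine ⟨({τ}, ∅), by simp, ?_, ?_⟩
    · intro τ' hτ' h0
      have : τ' = τ := by simpa using hτ'
      rw [← this, h0] at hτ
      simp at hτ
    · have : deg τ ≠ 0 := fun h0 => by
        rw [h0] at hτ
        simp at hτ
      simpa [vol] using Nat.pos_of_ne_zero this
  obtain ⟨⟨A, A'⟩, ⟨h1, h2, h3⟩, hmin⟩ :=
    Set.exists_min_image _ (fun A => beta o A.1 A.2) (Set.toFinite _) hP
  exact ⟨A, A', h1, h2, h3, fun B B' h1 h2 h3 => hmin (B, B') ⟨h1, h2, h3⟩⟩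

/-- The support of `f` contains a pair of sets whose ratio is bounded by the Rayleigh quotient. -/
theorem exists_pair_beta_sq_le (o : SimplexOrientation K) {f : Simplex K d → ℝ}
    (hf : 0 < ∑ τ, (deg τ : ℝ) * f τ ^ 2) :
    ∃ A A' : Finset (Simplex K d), Disjoint A A' ∧ (∀ τ ∈ A ∪ A', f τ ≠ 0) ∧ 0 < vol (A ∪ A') ∧
      beta o A A' ^ 2 * ∑ τ, (deg τ : ℝ) * f τ ^ 2 ≤
        2 * ((d : ℝ) + 1) * signedEnergy (signedAdj o) f := by
  obtain ⟨A, A', hA1, hA2, hA3, hmin⟩ := exists_pair_beta_le o hf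
  refine ⟨A, A', hA1, hA2, hA3, ?_⟩
  refine sq_mul_sum_le_signedEnergy (signedAdj_cases o) (signedAdj_comm o)
    (fun τ => Nat.cast_nonneg (deg τ)) (by positivity) (sum_abs_signedAdj o) f
    (beta_nonneg o A A') fun t ht => ?_
  set B : Finset (Simplex K d) := {τ | t < f τ ^ 2 ∧ 0 < f τ} with hB
  set B' : Finset (Simplex K d) := {τ | t < f τ ^ 2 ∧ ¬ 0 < f τ} with hB'
  have hBB : Disjoint B B' := by
    rw [Finset.disjoint_left]
    intro τ h1 h2
    exact (Finset.mem_filter.1 h2).2.2 (Finset.mem_filter.1 h1).2.2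
  have hlev : levelSign f t = pairSign B B' := by
    ext τ
    unfold levelSign pairSign
    by_cases h1 : t < f τ ^ 2 <;> by_cases h2 : 0 < f τ <;> simp [hB, hB', h1, h2]
  rw [hlev, sum_deg_mul_abs_pairSign]
  -- Level pairs of volume 0 have no ratio, but for them the required inequality is trivial.
  rcases Nat.eq_zero_or_pos (vol (B ∪ B')) with h0 | h0
  · rw [h0, Nat.cast_zero, mul_zero]
    unfold signedVariation
    positivity
  · have hsupp : ∀ τ ∈ B ∪ B', f τ ≠ 0 := fun τ hτ hf0 => by
      have h1 : t < f τ ^ 2 := by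
        rcases Finset.mem_union.1 hτ with h | h <;> exact (Finset.mem_filter.1 h).2.1
      rw [hf0, zero_pow two_ne_zero] at h1
      exact h1.not_ge ht
    have h1 := hmin B B' hBB hsupp h0
    rw [beta_eq o hBB] at h1
    exact (le_div_iff₀ (by exact_mod_cast h0)).1 h1

theorem cheeger_nonneg (o : SimplexOrientation K) (k : ℕ) : 0 ≤ cheeger o d k :=
  Real.iInf_nonneg fun _ => Real.iSup_nonneg fun _ => beta_nonneg o _ _

/-- Disjointly supported functions with small Rayleigh quotients bound the Cheeger constant. -/
theorem cheeger_sq_le (o : SimplexOrientation K) {k : ℕ} {ψ : Fin k → Simplex K d → ℝ}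
    (hdisj : ∀ i j, i ≠ j → ∀ τ, ψ i τ = 0 ∨ ψ j τ = 0)
    (hpos : ∀ i, 0 < ∑ τ, (deg τ : ℝ) * ψ i τ ^ 2) {M : ℝ} (hM0 : 0 ≤ M)
    (hM : ∀ i, signedEnergy (signedAdj o) (ψ i) ≤ M * ∑ τ, (deg τ : ℝ) * ψ i τ ^ 2) :
    cheeger o d k ^ 2 ≤ 2 * ((d : ℝ) + 1) * M := by
  classical
  choose A A' hAA hsupp hvol hbeta using fun i => exists_pair_beta_sq_le o (hpos i)
  obtain ⟨B, hB0, hB1⟩ : ∃ B : Fin k × Fin 2 → Finset (Simplex K d),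
      (∀ i, B (i, 0) = A i) ∧ ∀ i, B (i, 1) = A' i :=
    ⟨fun p => if p.2 = 0 then A p.1 else A' p.1, fun i => by simp, fun i => by simp⟩
  have hBsub : ∀ i a, B (i, a) ⊆ A i ∪ A' i := fun i a => by
    fin_cases a
    · exact (hB0 i).subset.trans Finset.subset_union_left
    · exact (hB1 i).subset.trans Finset.subset_union_right
  have hB : IsAdmissible B := by
    refine ⟨?_, fun i => by rw [hB0, hB1]; exact hvol i⟩
    rintro ⟨i, a⟩ ⟨j, b⟩ hne
    by_cases hij : i = j
    · subst hij
      have h01 : Disjoint (B (i, 0)) (B (i, 1)) := by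
        rw [hB0, hB1]
        exact hAA i
      fin_cases a <;> fin_cases b
      · exact absurd rfl hne
      · exact h01
      · exact h01.symm
      · exact absurd rfl hne
    · rw [Finset.disjoint_left]
      intro τ h1 h2
      rcases hdisj i j hij τ with h | h
      · exact hsupp i τ (hBsub i a h1) h
      · exact hsupp j τ (hBsub j b h2) h
  have hbnd : ∀ i, beta o (A i) (A' i) ≤ Real.sqrt (2 * ((d : ℝ) + 1) * M) := fun i => by
    refine Real.le_sqrt_of_sq_le ?_
    have h1 := mul_le_mul_of_nonneg_left (hM i) (show 0 ≤ 2 * ((d : ℝ) + 1) by positivity)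
    rw [← mul_assoc] at h1
    exact le_of_mul_le_mul_right ((hbeta i).trans h1) (hpos i)
  have hch : cheeger o d k ≤ Real.sqrt (2 * ((d : ℝ) + 1) * M) :=
    (ciInf_le (Set.finite_range _).bddBelow ⟨B, hB⟩).trans
      (Real.iSup_le (fun i => by dsimp only; rw [hB0, hB1]; exact hbnd i) (Real.sqrt_nonneg _))
  calc cheeger o d k ^ 2 ≤ Real.sqrt (2 * ((d : ℝ) + 1) * M) ^ 2 :=
        pow_le_pow_left₀ (cheeger_nonneg o k) hch 2
    _ = 2 * ((d : ℝ) + 1) * M := Real.sq_sqrt (by positivity)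

end LowerBound

/-! ### Test functions from admissible families. -/

section UpperBound

variable {V : Type*} [Finite V] {K : PreAbstractSimplicialComplex V} {d : ℕ}

omit [Finite V] in
theorem pairSign_cases (A A' : Finset (Simplex K d)) (τ : Simplex K d) :
    pairSign A A' τ = 0 ∨ pairSign A A' τ = 1 ∨ pairSign A A' τ = -1 := by
  unfold pairSign
  split_ifs <;> simp

omit [Finite V] in
theorem IsAdmissible.exists_forall_ne_pairSign_eq_zero {k : ℕ} (hk : 1 ≤ k)
    {A : Fin k × Fin 2 → Finset (Simplex K d)} (hA : IsAdmissible A) (τ : Simplex K d) :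
    ∃ i, ∀ j, j ≠ i → pairSign (A (j, 0)) (A (j, 1)) τ = 0 := by
  by_cases h : ∃ i a, τ ∈ A (i, a)
  · obtain ⟨i, a, hi⟩ := h
    refine ⟨i, fun j hj => ?_⟩
    have hnot : ∀ b, τ ∉ A (j, b) := fun b hb =>
      Finset.disjoint_left.1 (hA.1 (show (i, a) ≠ (j, b) from fun h => hj (by simp_all))) hi hb
    simp [pairSign, hnot]
  · push Not at h
    exact ⟨⟨0, hk⟩, fun j _ => by simp [pairSign, h]⟩

omit [Finite V] in
theorem IsAdmissible.sq_sum_eq {k : ℕ} (hk : 1 ≤ k)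
    {A : Fin k × Fin 2 → Finset (Simplex K d)} (hA : IsAdmissible A) (c : Fin k → ℝ)
    (τ : Simplex K d) : (∑ i, c i * pairSign (A (i, 0)) (A (i, 1)) τ) ^ 2 =
      ∑ i, c i ^ 2 * |pairSign (A (i, 0)) (A (i, 1)) τ| := by
  obtain ⟨i, hi⟩ := hA.exists_forall_ne_pairSign_eq_zero hk τ
  rw [Finset.sum_eq_single i (fun j _ hj => by simp [hi j hj]) (by simp),
    Finset.sum_eq_single i (fun j _ hj => by simp [hi j hj]) (by simp)]
  rcases pairSign_cases (A (i, 0)) (A (i, 1)) τ with h | h | h <;> simp [h]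

-- Only one index i survives at τ and one index j at τ'. If i = j, the difference is at most 2 in
-- absolute value, so its square is at most twice its absolute value; if i ≠ j, use (a - b)² ≤ 2a² +
-- 2b².
omit [Finite V] in
theorem IsAdmissible.sq_sub_le {k : ℕ} (hk : 1 ≤ k)
    {A : Fin k × Fin 2 → Finset (Simplex K d)} (hA : IsAdmissible A) (c : Fin k → ℝ)
    (τ τ' : Simplex K d) {s : ℝ} (hs : s = 1 ∨ s = -1) :
    (∑ i, c i * pairSign (A (i, 0)) (A (i, 1)) τ -
      s * ∑ i, c i * pairSign (A (i, 0)) (A (i, 1)) τ') ^ 2 ≤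
      ∑ i, 2 * c i ^ 2 *
        |pairSign (A (i, 0)) (A (i, 1)) τ - s * pairSign (A (i, 0)) (A (i, 1)) τ'| := by
  set χ : Fin k → Simplex K d → ℝ := fun i => pairSign (A (i, 0)) (A (i, 1)) with hχ
  have hχc : ∀ i τ, χ i τ = 0 ∨ χ i τ = 1 ∨ χ i τ = -1 := fun i τ => pairSign_cases _ _ τ
  change (∑ i, c i * χ i τ - s * ∑ i, c i * χ i τ') ^ 2 ≤
    ∑ i, 2 * c i ^ 2 * |χ i τ - s * χ i τ'|
  obtain ⟨i, hi⟩ := hA.exists_forall_ne_pairSign_eq_zero hk τ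
  obtain ⟨j, hj⟩ := hA.exists_forall_ne_pairSign_eq_zero hk τ'
  replace hi : ∀ l, l ≠ i → χ l τ = 0 := hi
  replace hj : ∀ l, l ≠ j → χ l τ' = 0 := hj
  rw [Finset.sum_eq_single i (fun l _ hl => by simp [hi l hl]) (by simp),
    Finset.sum_eq_single j (fun l _ hl => by simp [hj l hl]) (by simp)]
  have hnn : ∀ l ∈ Finset.univ, 0 ≤ 2 * c l ^ 2 * |χ l τ - s * χ l τ'| := fun l _ => by positivity
  by_cases hij : i = j
  · subst hij
    refine le_trans ?_ (Finset.single_le_sum hnn (Finset.mem_univ i))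
    have h1 : c i * χ i τ - s * (c i * χ i τ') = c i * (χ i τ - s * χ i τ') := by ring
    rw [h1, mul_pow, ← sq_abs (χ i τ - _)]
    have h2 : |χ i τ - s * χ i τ'| ≤ 2 := by
      rcases hs with rfl | rfl <;> rcases hχc i τ with h | h | h <;>
        rcases hχc i τ' with h' | h' | h' <;> rw [h, h'] <;> norm_num
    nlinarith [mul_nonneg (mul_nonneg (sq_nonneg (c i)) (abs_nonneg (χ i τ - s * χ i τ')))
      (sub_nonneg.2 h2)]
  · have h1 : 2 * c i ^ 2 * |χ i τ - s * χ i τ'| + 2 * c j ^ 2 * |χ j τ - s * χ j τ'| ≤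
        ∑ l, 2 * c l ^ 2 * |χ l τ - s * χ l τ'| := by
      rw [← Finset.sum_pair (f := fun l => 2 * c l ^ 2 * |χ l τ - s * χ l τ'|) hij]
      exact Finset.sum_le_sum_of_subset_of_nonneg (Finset.subset_univ _) fun l hl _ =>
        hnn l (Finset.mem_univ l)
    refine le_trans ?_ h1
    rw [hi j (Ne.symm hij), hj i hij, mul_zero, sub_zero, zero_sub, abs_neg, abs_mul]
    have hss : |s| = 1 := by rcases hs with rfl | rfl <;> simp
    have h3 : ∀ l τ, |χ l τ| = χ l τ ^ 2 := fun l τ => by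
      rcases hχc l τ with h | h | h <;> rw [h] <;> norm_num
    have h4 : s ^ 2 = 1 := by rcases hs with rfl | rfl <;> norm_num
    rw [hss, one_mul, h3, h3]
    have h5 : (s * (c j * χ j τ')) ^ 2 = c j ^ 2 * χ j τ' ^ 2 := by
      rw [mul_pow, h4]
      ring
    nlinarith [sq_nonneg (c i * χ i τ + s * (c j * χ j τ'))]

theorem IsAdmissible.signedEnergy_le {k : ℕ} (hk : 1 ≤ k) (o : SimplexOrientation K)
    {A : Fin k × Fin 2 → Finset (Simplex K d)} (hA : IsAdmissible A) (c : Fin k → ℝ) :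
    signedEnergy (signedAdj o) (fun τ => ∑ i, c i * pairSign (A (i, 0)) (A (i, 1)) τ) ≤
      2 * (⨆ i, beta o (A (i, 0)) (A (i, 1))) *
        ∑ τ, (deg τ : ℝ) * (∑ i, c i * pairSign (A (i, 0)) (A (i, 1)) τ) ^ 2 := by
  have hdisj : ∀ i, Disjoint (A (i, 0)) (A (i, 1)) := fun i =>
    hA.1 (show (i, (0 : Fin 2)) ≠ (i, 1) by simp)
  have h1 : signedEnergy (signedAdj o) (fun τ => ∑ i, c i * pairSign (A (i, 0)) (A (i, 1)) τ) ≤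
      ∑ i, 2 * c i ^ 2 * signedVariation (signedAdj o) (pairSign (A (i, 0)) (A (i, 1))) := by
    unfold signedEnergy signedVariation
    simp only [← mul_div_assoc]
    rw [← Finset.sum_div]
    refine div_le_div_of_nonneg_right ?_ (by norm_num)
    have hcomm : ∀ F : Fin k → Simplex K d → Simplex K d → ℝ,
        ∑ i, 2 * c i ^ 2 * ∑ τ, ∑ τ', F i τ τ' = ∑ τ, ∑ τ', ∑ i, 2 * c i ^ 2 * F i τ τ' := by
      intro F
      simp only [Finset.mul_sum]
      rw [Finset.sum_comm]
      exact Finset.sum_congr rfl fun τ _ => Finset.sum_comm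
    rw [hcomm]
    refine Finset.sum_le_sum fun τ _ => Finset.sum_le_sum fun τ' _ => ?_
    rcases signedAdj_cases o τ τ' with h0 | h0
    · simp [h0]
    · refine (mul_le_mul_of_nonneg_left (hA.sq_sub_le hk c τ τ' h0) (abs_nonneg _)).trans
        (le_of_eq ?_)
      rw [Finset.mul_sum]
      exact Finset.sum_congr rfl fun i _ => by ring
  have h2 : ∑ τ, (deg τ : ℝ) * (∑ i, c i * pairSign (A (i, 0)) (A (i, 1)) τ) ^ 2 =
      ∑ i, c i ^ 2 * vol (A (i, 0) ∪ A (i, 1)) := by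
    simp only [hA.sq_sum_eq hk, Finset.mul_sum, ← sum_deg_mul_abs_pairSign]
    rw [Finset.sum_comm]
    exact Finset.sum_congr rfl fun i _ => Finset.sum_congr rfl fun τ _ => by ring
  refine h1.trans ?_
  rw [h2, Finset.mul_sum]
  refine Finset.sum_le_sum fun i _ => ?_
  have h3 : beta o (A (i, 0)) (A (i, 1)) ≤ ⨆ i, beta o (A (i, 0)) (A (i, 1)) :=
    le_ciSup (Set.finite_range fun i => beta o (A (i, 0)) (A (i, 1))).bddAbove i
  rw [beta_eq o (hdisj i), div_le_iff₀ (by exact_mod_cast hA.2 i)] at h3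
  nlinarith [mul_le_mul_of_nonneg_left h3 (sq_nonneg (c i))]

theorem exists_isAdmissible {k : ℕ} (hk : k ≤ {τ : Simplex K d | 0 < deg τ}.ncard) :
    ∃ A : Fin k × Fin 2 → Finset (Simplex K d), IsAdmissible A := by
  classical
  have hcard : Fintype.card (Fin k) ≤ Fintype.card {τ : Simplex K d // 0 < deg τ} := by
    rwa [Fintype.card_fin, ← Nat.card_eq_fintype_card, ← Set.coe_ofPred, Nat.card_coe_set_eq]
  obtain ⟨p⟩ := Function.Embedding.nonempty_of_card_le hcard
  refine ⟨fun q => if q.2 = 0 then {(p q.1 : Simplex K d)} else ∅, ?_, fun i => ?_⟩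
  · rintro ⟨i, a⟩ ⟨j, b⟩ hne
    fin_cases a <;> fin_cases b <;> simp
    intro h
    exact hne (by rw [p.injective (Subtype.ext h)])
  · simpa [vol] using (p i).2

end UpperBound

/-! ### The inequalities for the up-Laplacian. -/

section Eigenvalue

variable {V : Type*} [Finite V] {K : PreAbstractSimplicialComplex V} {d : ℕ}

theorem ncard_deg_pos_le : {τ : Simplex K d | 0 < deg τ}.ncard ≤ Fintype.card (Simplex K d) := by
  rw [← Nat.card_eq_fintype_card]
  exact Set.ncard_le_card _

theorem eigenvalue_eq (o : SimplexOrientation K) {k : ℕ} (hk : 1 ≤ k)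
    (hkn : k ≤ Fintype.card (Simplex K d)) :
    eigenvalue o d (Nat.card (Simplex K d) + 1 - k) =
      (isHermitian_normalizedMatrix (fun τ : Simplex K d => (deg τ : ℝ))
        (gramMatrix_comm o d)).eigenvalues₀ ⟨k - 1, by lia⟩ := by
  rw [← getD_sort_roots_charpoly _ hk hkn, eigenvalue, upLaplacian_eq,
    charpoly_diagonal_inv_mul (fun τ => Nat.cast_nonneg (deg τ)), Nat.card_eq_fintype_card]
  congr 1
  lia

open Matrix in
theorem exists_orthonormal_signedEnergy_le (o : SimplexOrientation K) {k : ℕ} (hk : 1 ≤ k)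
    (hkn : k ≤ {τ : Simplex K d | 0 < deg τ}.ncard) :
    ∃ f : Fin k → Simplex K d → ℝ,
      (∀ i j, ∑ τ, (deg τ : ℝ) * (f i τ * f j τ) = if i = j then 1 else 0) ∧
      ∀ i, signedEnergy (signedAdj o) (f i) ≤
        (d : ℝ) + 2 - eigenvalue o d (Nat.card (Simplex K d) + 1 - k) := by
  have hkc := hkn.trans ncard_deg_pos_le
  obtain ⟨f, hf1, hf2⟩ := exists_orthonormal_eigenvalue_le
    (m := fun τ : Simplex K d => (deg τ : ℝ)) (fun τ => Nat.cast_nonneg (deg τ))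
    (gramMatrix_comm o d) (gramMatrix_nonneg o d) hk (by simpa only [Nat.cast_pos] using hkn) hkc
  refine ⟨f, hf1, fun i => ?_⟩
  have h1 := hf1 i i
  rw [if_pos rfl] at h1
  simp only [← sq] at h1
  rw [signedEnergy_signedAdj, h1, mul_one, eigenvalue_eq o hk hkc]
  exact sub_le_sub_left (hf2 i) _

open Matrix in
theorem sub_eigenvalue_le_two_mul_cheeger (o : SimplexOrientation K) {k : ℕ} (hk : 1 ≤ k)
    (hkn : k ≤ {τ : Simplex K d | 0 < deg τ}.ncard) :
    (d : ℝ) + 2 - eigenvalue o d (Nat.card (Simplex K d) + 1 - k) ≤ 2 * cheeger o d k := by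
  have hkc := hkn.trans ncard_deg_pos_le
  obtain ⟨A₀, hA₀⟩ := exists_isAdmissible hkn
  -- Without an admissible family the infimum would take the default value 0; here k ≤ n_+ enters.
  have : Nonempty {A : Fin k × Fin 2 → Finset (Simplex K d) // IsAdmissible A} := ⟨⟨A₀, hA₀⟩⟩
  suffices h : ((d : ℝ) + 2 - eigenvalue o d (Nat.card (Simplex K d) + 1 - k)) / 2 ≤
      cheeger o d k by linarith
  refine le_ciInf fun ⟨A, hA⟩ => ?_
  dsimp only
  set b := ⨆ i, beta o (A (i, 0)) (A (i, 1))
  suffices h : (d : ℝ) + 2 - 2 * b ≤ eigenvalue o d (Nat.card (Simplex K d) + 1 - k) by linarith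
  rw [eigenvalue_eq o hk hkc]
  refine le_eigenvalue_of_le_on_span (g := fun i => pairSign (A (i, 0)) (A (i, 1)))
    (fun τ => Nat.cast_nonneg (deg τ)) (gramMatrix_comm o d) (gramMatrix_of_deg_eq_zero o d) hk hkc
    (fun c hc => ?_) fun c => ?_
  · obtain ⟨i, hi⟩ := Function.ne_iff.1 hc
    simp only [hA.sq_sum_eq hk, Finset.mul_sum]
    rw [Finset.sum_comm]
    have h1 : ∀ j, ∑ τ, (deg τ : ℝ) * (c j ^ 2 * |pairSign (A (j, 0)) (A (j, 1)) τ|) =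
        c j ^ 2 * vol (A (j, 0) ∪ A (j, 1)) := fun j => by
      rw [← sum_deg_mul_abs_pairSign, Finset.mul_sum]
      exact Finset.sum_congr rfl fun τ _ => by ring
    simp only [h1]
    refine Finset.sum_pos' (fun j _ => by positivity) ⟨i, Finset.mem_univ i, ?_⟩
    have h2 : (0 : ℝ) < vol (A (i, 0) ∪ A (i, 1)) := by exact_mod_cast hA.2 i
    have h3 : c i ≠ 0 := hi
    positivity
  · have h1 := hA.signedEnergy_le hk o c
    rw [signedEnergy_signedAdj] at h1
    linarith

/-- A single function needs no localization, hence the sharper constant. -/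
theorem cheeger_one_sq_le (o : SimplexOrientation K)
    (hpos : 1 ≤ {τ : Simplex K d | 0 < deg τ}.ncard) :
    cheeger o d 1 ^ 2 ≤
      2 * ((d : ℝ) + 1) * ((d : ℝ) + 2 - eigenvalue o d (Nat.card (Simplex K d) + 1 - 1)) := by
  obtain ⟨f, hf1, hf2⟩ := exists_orthonormal_signedEnergy_le o le_rfl hpos
  have h1 : ∀ i, ∑ τ, (deg τ : ℝ) * f i τ ^ 2 = 1 := fun i => by
    simpa [← sq] using hf1 i i
  refine cheeger_sq_le o (ψ := f) (fun i j hij => absurd (Subsingleton.elim i j) hij)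
    (fun i => by rw [h1]; exact one_pos) ((signedEnergy_nonneg _ _).trans (hf2 0))
    fun i => by rw [h1, mul_one]; exact hf2 i

theorem cheeger_sq_le_pow_six (o : SimplexOrientation K) {k : ℕ} (hk : 1 ≤ k)
    (hkn : k ≤ {τ : Simplex K d | 0 < deg τ}.ncard) :
    cheeger o d k ^ 2 ≤ 2 * ((d : ℝ) + 1) *
      (9216 * k ^ 6 * ((d : ℝ) + 2 - eigenvalue o d (Nat.card (Simplex K d) + 1 - k))) := by
  obtain ⟨f, hf1, hf2⟩ := exists_orthonormal_signedEnergy_le o hk hkn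
  obtain ⟨ψ, h1, h2, h3⟩ := exists_disjoint_support_signedEnergy_le (signedAdj_cases o)
    (m := fun τ : Simplex K d => (deg τ : ℝ)) (fun τ => Nat.cast_nonneg (deg τ)) hk hf1 hf2
  have h0 := (signedEnergy_nonneg _ _).trans (hf2 ⟨0, hk⟩)
  exact cheeger_sq_le o h1 h2 (by positivity) h3

end Eigenvalue

end SimplicialCheeger

theorem mainTheorem2 :
    (∀ (V : Type*) [Finite V] (K : PreAbstractSimplicialComplex V)
        (o : SimplicialCheeger.SimplexOrientation K) (d : ℕ),
        (∃ τ : SimplicialCheeger.Simplex K d, 0 < SimplicialCheeger.deg τ) →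
        SimplicialCheeger.cheeger o d 1 ^ 2 / (2 * ((d : ℝ) + 1)) ≤
            (d : ℝ) + 2 -
              SimplicialCheeger.eigenvalue o d (Nat.card (SimplicialCheeger.Simplex K d)) ∧
          (d : ℝ) + 2 -
              SimplicialCheeger.eigenvalue o d (Nat.card (SimplicialCheeger.Simplex K d)) ≤
            2 * SimplicialCheeger.cheeger o d 1) ∧
    ∃ C : ℝ, 0 < C ∧
      ∀ (V : Type*) [Finite V] (K : PreAbstractSimplicialComplex V)
        (o : SimplicialCheeger.SimplexOrientation K) (d k : ℕ),
        1 ≤ k →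
        k ≤ {τ : SimplicialCheeger.Simplex K d | 0 < SimplicialCheeger.deg τ}.ncard →
        SimplicialCheeger.cheeger o d k ^ 2 / (C * (k : ℝ) ^ 6 * ((d : ℝ) + 1)) ≤
            (d : ℝ) + 2 -
              SimplicialCheeger.eigenvalue o d
                (Nat.card (SimplicialCheeger.Simplex K d) + 1 - k) ∧
          (d : ℝ) + 2 -
              SimplicialCheeger.eigenvalue o d
                (Nat.card (SimplicialCheeger.Simplex K d) + 1 - k) ≤
            2 * SimplicialCheeger.cheeger o d k := by
  -- 18432 = 2 · 9216: the factor 2 of Cheeger's inequality times the localization constant.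
  refine ⟨fun V _ K o d hpos => ?_, 18432, by norm_num, fun V _ K o d k hk hkn => ?_⟩
  · have h1 : 1 ≤ {τ : SimplicialCheeger.Simplex K d | 0 < SimplicialCheeger.deg τ}.ncard :=
      (Set.ncard_pos (Set.toFinite _)).2 hpos
    have h2 := SimplicialCheeger.cheeger_one_sq_le o h1
    have h3 := SimplicialCheeger.sub_eigenvalue_le_two_mul_cheeger o le_rfl h1
    rw [Nat.add_sub_cancel] at h2 h3
    refine ⟨?_, h3⟩
    rw [div_le_iff₀ (by positivity)]
    linarith
  · refine ⟨?_, SimplicialCheeger.sub_eigenvalue_le_two_mul_cheeger o hk hkn⟩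
    have hk0 : (0 : ℝ) < k := by exact_mod_cast hk
    rw [div_le_iff₀ (by positivity)]
    have h := SimplicialCheeger.cheeger_sq_le_pow_six o hk hkn
    linarith
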